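/- **Theorem.** For positive real numbers $k,N$ with $k+N>1$ and $x\in\mathbb{C}\setminus(-\infty,0]$ let $$\mathscr{F}_{k,N}(x):=\sum_{n=1}^{\infty}\frac{\psi(n^{N}x)-\log(n^{N}x)}{n^{k}},$$ where $\psi=\Gamma'/\Gamma$; logarithms and complex powers take their principal values. Let $\gamma$ be Euler's constant, $\gamma_1=\lim_{n\to\infty}\big(\sum_{i=1}^{n}\frac{\log i}{i}-\frac{(\log n)^2}{2}\big)$ the first Stieltjes constant and $\zeta$ the Riemann zeta function. For positive integers $k,N$ put $$\mathscr{B}(k,N,x):=\begin{cases}(-1)^{k+N+1}x^{1/N}\zeta\left(1+\frac{k}{N}\right)&\text{if }k=N,\\0&\text{if }k\neq N,\end{cases}$$ and let $\sum''_{j}$ denote the sum over $j=-(N-1),-(N-3),\dots,N-3,N-1$. (a) Let $k,N$ be natural numbers with $1<k\le N$ and let $x\in\mathbb{C}\setminus(-\infty,0]$. Then $$\begin{aligned}&x^{\frac{1-k}{N}}\mathscr{F}_{k,N}(x)-\frac{(-1)^k}{N}\sum_{j}{}''\,e^{i\pi j(k-1)/N}\,\mathscr{F}_{\frac{N+k-1}{N},\frac1N}\left(\frac{e^{-i\pi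 j/N}}{x^{1/N}}\right)\\&=\frac{\pi}{N}\,\frac{\zeta\left(1+\frac{k-1}{N}\right)}{\sin\left(\frac{\pi}{N}(k-1)\right)}+x^{\frac{1-k}{N}}\Big(-(\gamma+\log x)\zeta(k)+N\zeta'(k)\Big)-\frac{\zeta(k+N)}{x^{\frac{N+k-1}{N}}}+\mathscr{B}(k,N,x).\end{aligned}$$ (b) Let $N\ge1$ be a natural number and let $x\in\mathbb{C}\setminus(-\infty,0]$. Then $$\begin{aligned}&\mathscr{F}_{1,N}(x)+\frac1N\sum_{j}{}''\,\mathscr{F}_{1,\frac1N}\left(\frac{e^{-i\pi j/N}}{x^{1/N}}\right)\\&=\frac1N\left\{\frac{\pi^2}{6}-(N-1)\gamma\log x+\frac12(\log x)^2-N\gamma^2-(N^2+1)\gamma_1\right\}-\frac{\zeta(N+1)}{x}+\mathscr{B}(1,N,x).\end{aligned}$$ In (a) and (b) all the series $\mathscr{F}$ that occur converge absolutely. In particular, for $N=1$, the function $F=\mathscr{F}_{1,1}$ satisfies, for all $x\in\mathbb{C}\setminus(-\infty,0]$, $$F(x)+F\left(\frac1x\right)=2F(1)+\frac12\log^2x-\frac{\pi^2}{6x}(x-1)^2.$$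 -/

import Mathlib

/-- The `n`-th term (`n ≥ 1` is written as `n + 1` with `n : ℕ`) of the series defining the extended
higher Herglotz function: `(ψ(n^N x) - log(n^N x)) / n^k`, with real `k`, `N`, the digamma function
`ψ = Γ'/Γ` and the principal branch of the logarithm. -/
noncomputable def herglotzTerm (k N : ℝ) (x : ℂ) (n : ℕ) : ℂ :=
  (Complex.digamma (((((n : ℝ) + 1) ^ N : ℝ) : ℂ) * x)
      - Complex.log (((((n : ℝ) + 1) ^ N : ℝ) : ℂ) * x))
    / ((((n : ℝ) + 1) ^ k : ℝ) : ℂ)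

/-- The extended higher Herglotz function `𝓕_{k,N}(x) = ∑_{n ≥ 1} (ψ(n^N x) - log(n^N x)) / n^k`. -/
noncomputable def extHerglotz (k N : ℝ) (x : ℂ) : ℂ := ∑' n : ℕ, herglotzTerm k N x n

/-- The index set `{-(N-1), -(N-3), …, N-3, N-1}` of the double-prime sums. -/
def dprimeIndex (N : ℕ) : Finset ℤ :=
  (Finset.range N).image fun m : ℕ => 2 * (m : ℤ) - ((N : ℤ) - 1)

/-- The term `𝓑(k, N, x)`. -/
noncomputable def bTerm (k N : ℕ) (x : ℂ) : ℂ :=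
  if k = N then
    (-1) ^ (k + N + 1) * x ^ (1 / (N : ℂ)) * riemannZeta (1 + (k : ℂ) / (N : ℂ))
  else 0

/-- The argument `e^{-iπj/N} / x^{1/N}` (principal root) of the twisted functions. -/
noncomputable def twistArg (N : ℕ) (j : ℤ) (x : ℂ) : ℂ :=
  Complex.exp (-(Complex.I * Real.pi * (j : ℂ) / (N : ℂ))) / x ^ (1 / (N : ℂ))

/-- `∑_{1 ≤ i ≤ n} (log i) / i - (log n)² / 2`. -/
noncomputable def stieltjesOneSeq (n : ℕ) : ℝ :=
  ∑ i ∈ Finset.Icc 1 n, Real.log i / i - Real.log n ^ 2 / 2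

/-- The first Stieltjes constant `γ₁ = lim_n (∑_{1 ≤ i ≤ n} (log i) / i - (log n)² / 2)`. -/
noncomputable def stieltjesOne : ℝ := Filter.limUnder Filter.atTop stieltjesOneSeq

theorem log_sq_step (n : ℕ) (hn : 3 ≤ n) :
    Real.log (n + 1 : ℕ) / (n + 1 : ℕ) ≤ Real.log (n + 1 : ℕ) ^ 2 / 2 - Real.log n ^ 2 / 2 ∧
    Real.log (n + 1 : ℕ) ^ 2 / 2 - Real.log n ^ 2 / 2 ≤ Real.log n / n := by
  have hn' : (3 : ℝ) ≤ n := by exact_mod_cast hn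
  have he : Real.exp 1 ≤ 3 := by linarith [Real.exp_one_lt_d9]
  obtain ⟨c, ⟨hc1, hc2⟩, hc⟩ := exists_hasDerivAt_eq_slope
    (fun t : ℝ => Real.log t ^ 2 / 2) (fun t : ℝ => Real.log t / t)
    (a := (n : ℝ)) (b := (n : ℝ) + 1) (by linarith)
    (by
      apply ContinuousOn.div_const
      apply ContinuousOn.pow
      apply Real.continuousOn_log.mono
      intro t ht
      have : (0 : ℝ) < t := by linarith [ht.1]
      exact this.ne')
    (by
      intro t ht
      have ht0 : t ≠ 0 := by
        have : (0 : ℝ) < t := by linarith [ht.1]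
        exact this.ne'
      have h := ((Real.hasDerivAt_log ht0).pow 2).div_const 2
      refine h.congr_deriv ?_
      push_cast
      ring)
  have e : (n : ℝ) + 1 - n = 1 := by ring
  rw [e, div_one] at hc
  push_cast
  refine ⟨?_, ?_⟩
  · rw [← hc]
    exact Real.log_div_self_antitoneOn (Set.mem_Ici.2 (by linarith)) (Set.mem_Ici.2 (by linarith)) hc2.le
  · rw [← hc]
    exact Real.log_div_self_antitoneOn (Set.mem_Ici.2 (by linarith)) (Set.mem_Ici.2 (by linarith)) hc1.le

/-- The limit defining `γ₁` exists. -/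
theorem tendsto_stieltjesOneSeq :
    Filter.Tendsto stieltjesOneSeq Filter.atTop (nhds stieltjesOne) := by
  apply tendsto_nhds_limUnder
  have hS : ∀ n : ℕ, ∑ i ∈ Finset.Icc 1 (n + 1), Real.log (i : ℝ) / i
      = ∑ i ∈ Finset.Icc 1 n, Real.log (i : ℝ) / i + Real.log (n + 1 : ℕ) / (n + 1 : ℕ) := by
    intro n
    rw [Finset.sum_Icc_succ_top (by omega)]
  have hanti : Antitone fun m : ℕ => stieltjesOneSeq (m + 3) := by
    apply antitone_nat_of_succ_le
    intro m
    have h := (log_sq_step (m + 3) (by omega)).1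
    have h' := hS (m + 3)
    simp only [stieltjesOneSeq, show m + 1 + 3 = m + 3 + 1 by ring]
    rw [h']
    linarith
  have hmono : Monotone fun m : ℕ =>
      stieltjesOneSeq (m + 3) - Real.log (m + 3 : ℕ) / (m + 3 : ℕ) := by
    apply monotone_nat_of_le_succ
    intro m
    have h := (log_sq_step (m + 3) (by omega)).2
    have h' := hS (m + 3)
    simp only [stieltjesOneSeq, show m + 1 + 3 = m + 3 + 1 by ring]
    rw [h']
    linarith
  have hb : BddBelow (Set.range fun m : ℕ => stieltjesOneSeq (m + 3)) := by
    refine ⟨stieltjesOneSeq (0 + 3) - Real.log (0 + 3 : ℕ) / (0 + 3 : ℕ), ?_⟩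
    rintro _ ⟨m, rfl⟩
    have h1 := hmono (Nat.zero_le m)
    have h2 : 0 ≤ Real.log (m + 3 : ℕ) / (m + 3 : ℕ) :=
      div_nonneg (Real.log_natCast_nonneg _) (Nat.cast_nonneg _)
    simp only at h1 ⊢
    linarith
  exact ⟨_, (Filter.tendsto_add_atTop_iff_nat 3).1 (tendsto_atTop_ciInf hanti hb)⟩

/-! Put p = k - 1, ω_j = e^{-iπj/N} and w_j = ω_j / x^{1/N}. Since ψ(z+1) + γ = ∑_m (1/m - 1/(z+m))
(`hasSum_digamma`), the sum ∑_n (ψ(n^N x+1) + γ)/n^k is a double series with terms n^{N-k} x / (m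
(n^N x + m)). The -m^{1/N} w_j are the roots in n of n^N x + m, so for k ≤ N partial fractions in n
(`doubleTerm_eq_sum`) turn each term into a multiple of ∑_j ω_j^{-p} / (n + m^{1/N} w_j).

For 1 < k ≤ N the double series converges absolutely, and ∑_j ω_j^{-p} = 0 makes the sum over n a
combination of the ψ(m^{1/N} w_j + 1). Exchanging the sums gives the formula: ∑_j ω_j^{-p} log w_j
produces π/sin, and passing from ψ(z+1) to ψ(z) produces ζ(k+N)/x and 𝓑. The latter survives only
for k = N, because ∑_j ω_j^{-k} vanishes unless N divides k.

For k = 1 the cancellation is lost, so n is cut off at X. The inner sums become ψ(m^{1/N} w_j + X +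
1) - ψ(m^{1/N} w_j + 1). Replacing the first ψ by a logarithm costs o(1) in total, and the
logarithms combine over j into log(1 + X^N x/m) (`truncatedSum_eq`). What remains is the asymptotics
of L(Y) = ∑_m log(1 + Y/m)/m, namely (log Y)²/2 + γ log Y + C + o(1). Here C does not depend on the
direction of Y (`tendsto_logSumRemainder_sub`), and N = 1, x = 1 gives C = π²/6 - γ₁, because there
the cut-off sum is ∑ H_n/n.

All estimates rest on ψ(z+1) - log z = O(1/|z|), uniformly in sectors
(`SectorBound.norm_digamma_sub_log_le`). -/

/-! ### Sectors in the slit plane. -/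

/-- `z` lies in a sector around the positive real axis, quantified by `c`. -/
def SectorBound (c : ℝ) (z : ℂ) : Prop := ∀ r : ℝ, 0 ≤ r → c * (‖z‖ + r) ≤ ‖z + r‖

/-- The constant is scale invariant, so one `c` for `x` serves all the points n^N x at once. -/
theorem SectorBound.smul {c t : ℝ} {z : ℂ} (h : SectorBound c z) (ht : 0 < t) :
    SectorBound c ((t : ℂ) * z) := by
  intro r hr
  have h1 := h (r / t) (by positivity)
  have h2 : (t : ℂ) * z + r = t * (z + ((r / t : ℝ) : ℂ)) := by
    have : (t : ℂ) ≠ 0 := by exact_mod_cast ht.ne'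
    push_cast
    field_simp
  rw [h2, norm_mul, norm_mul, Complex.norm_of_nonneg ht.le]
  calc c * (t * ‖z‖ + r) = t * (c * (‖z‖ + r / t)) := by field_simp
    _ ≤ _ := by gcongr

theorem SectorBound.add_ofReal {c r : ℝ} {z : ℂ} (h : SectorBound c z) (hc : 0 ≤ c) (hr : 0 ≤ r) :
    SectorBound c (z + r) := by
  intro s hs
  have h1 := h (r + s) (by positivity)
  have h2 : ‖z + r‖ ≤ ‖z‖ + r := (norm_add_le _ _).trans (by rw [Complex.norm_of_nonneg hr])
  push_cast at h1
  rw [add_assoc]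
  refine le_trans ?_ h1
  have : ‖z + r‖ + s ≤ ‖z‖ + (r + s) := by linarith
  gcongr

theorem norm_add_re_pos {z : ℂ} (hz : z ∈ Complex.slitPlane) : 0 < ‖z‖ + z.re := by
  rcases hz with h | h
  · positivity
  · have := Complex.abs_re_lt_norm.2 h
    have := neg_abs_le z.re
    linarith

/-- The constant is cos(θ/2) with θ = arg z; equality holds at r = ‖z‖. -/
theorem sectorBound_sqrt {z : ℂ} (hz : z ≠ 0) :
    SectorBound (Real.sqrt ((‖z‖ + z.re) / (2 * ‖z‖))) z := by
  intro r hr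
  have hn : 0 < ‖z‖ := norm_pos_iff.2 hz
  have hre : 0 ≤ ‖z‖ + z.re := by
    have := neg_le_of_abs_le (Complex.abs_re_le_norm z)
    linarith
  have hre' : z.re ≤ ‖z‖ := Complex.re_le_norm z
  apply le_of_sq_le_sq _ (norm_nonneg _)
  rw [mul_pow, Real.sq_sqrt (by positivity), Complex.sq_norm, Complex.normSq_apply]
  have hsq : ‖z‖ ^ 2 = z.re * z.re + z.im * z.im := by rw [Complex.sq_norm, Complex.normSq_apply]
  have e : (‖z‖ + z.re) / (2 * ‖z‖) * (‖z‖ + r) ^ 2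
      = ‖z‖ ^ 2 + 2 * r * z.re + r ^ 2 - (‖z‖ - z.re) / (2 * ‖z‖) * (‖z‖ - r) ^ 2 := by
    field_simp
    ring
  have : 0 ≤ (‖z‖ - z.re) / (2 * ‖z‖) * (‖z‖ - r) ^ 2 := by
    have : 0 ≤ ‖z‖ - z.re := by linarith
    positivity
  rw [e]
  simp
  nlinarith

theorem exists_sectorBound {z : ℂ} (hz : z ∈ Complex.slitPlane) : ∃ c, 0 < c ∧ SectorBound c z := by
  have h0 := Complex.slitPlane_ne_zero hz
  have hn : 0 < ‖z‖ := norm_pos_iff.2 h0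
  have := norm_add_re_pos hz
  exact ⟨_, by positivity, sectorBound_sqrt h0⟩

theorem add_ofReal_mem_slitPlane {z : ℂ} (hz : z ∈ Complex.slitPlane) {r : ℝ} (hr : 0 ≤ r) :
    z + r ∈ Complex.slitPlane := by
  rw [Complex.mem_slitPlane_iff] at *
  rcases hz with h | h
  · left; simp; linarith
  · right; simpa using h

theorem ofReal_mul_mem_slitPlane {z : ℂ} (hz : z ∈ Complex.slitPlane) {r : ℝ} (hr : 0 < r) :
    (r : ℂ) * z ∈ Complex.slitPlane := by
  rw [Complex.mem_slitPlane_iff] at *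
  rcases hz with h | h
  · left; simp; positivity
  · right; simp [hr.ne', h]

theorem add_natCast_mem_slitPlane {z : ℂ} (hz : z ∈ Complex.slitPlane) (n : ℕ) :
    z + n ∈ Complex.slitPlane := by
  have := add_ofReal_mem_slitPlane hz (r := n) (by positivity)
  simpa using this

/-! ### Partial fractions of the digamma function. -/

/-- The terms of a series for `log Γ(z + 1)`. -/
noncomputable def logGammaTerm (l : ℕ) (z : ℂ) : ℂ :=
  (Real.log (l + 1) : ℂ) - Complex.log (z + (l + 1)) + z * ((Real.log (l + 1) - Real.log l : ℝ) : ℂ)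

/-- On this half-plane Re(z + l + 1) ≥ (l + 1)/2, which gives uniform bounds. It also contains 0,
where all terms of the series vanish. -/
theorem natCast_add_mem_slitPlane_of_re {z : ℂ} (hz : -(1 / 2) < z.re) (l : ℕ) :
    z + (l + 1) ∈ Complex.slitPlane := by
  left
  simp
  have : (0 : ℝ) ≤ l := by positivity
  linarith

theorem hasDerivAt_logGammaTerm {z : ℂ} (hz : -(1 / 2) < z.re) (l : ℕ) :
    HasDerivAt (logGammaTerm l)
      (((Real.log (l + 1) - Real.log l : ℝ) : ℂ) - 1 / (z + (l + 1))) z := by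
  have h1 := ((hasDerivAt_id z).add_const ((l : ℂ) + 1)).clog (natCast_add_mem_slitPlane_of_re hz l)
  have h2 := ((h1.const_sub ((Real.log (l + 1) : ℝ) : ℂ))).add
    ((hasDerivAt_id z).mul_const ((Real.log (l + 1) - Real.log l : ℝ) : ℂ))
  refine h2.congr_deriv ?_
  simp
  ring

theorem abs_log_step_sub_le (l : ℕ) :
    |Real.log (l + 1) - Real.log l - 1 / (l + 1)| ≤ 4 * (1 / ((l : ℝ) + 1) ^ 2) := by
  -- For l = 0 the convention `Real.log 0 = 0` makes the left side equal to 1.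
  rcases Nat.eq_zero_or_pos l with rfl | hl
  · simp
  have hl' : (1 : ℝ) ≤ l := by exact_mod_cast hl
  have h1 : Real.log (l + 1) - Real.log l ≤ 1 / l := by
    rw [← Real.log_div (by positivity) (by positivity)]
    refine (Real.log_le_sub_one_of_pos (by positivity)).trans (le_of_eq ?_)
    field_simp
    ring
  have h2 : 1 / ((l : ℝ) + 1) ≤ Real.log (l + 1) - Real.log l := by
    have := Real.log_le_sub_one_of_pos (x := (l : ℝ) / (l + 1)) (by positivity)
    rw [Real.log_div (by positivity) (by positivity)] at this
    have e : (l : ℝ) / (l + 1) - 1 = - (1 / ((l : ℝ) + 1)) := by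
      field_simp
      ring
    linarith
  rw [abs_of_nonneg (by linarith)]
  have : 1 / (l : ℝ) - 1 / (l + 1) ≤ 4 * (1 / ((l : ℝ) + 1) ^ 2) := by
    rw [div_sub_div _ _ (by positivity) (by positivity), mul_one_div, div_le_div_iff₀ (by positivity) (by positivity)]
    nlinarith
  linarith

theorem norm_logGammaTerm_deriv_le {R : ℝ} {z : ℂ} (hz : -(1 / 2) < z.re) (hR : ‖z‖ ≤ R) (l : ℕ) :
    ‖((Real.log (l + 1) - Real.log l : ℝ) : ℂ) - 1 / (z + (l + 1))‖
      ≤ (4 + 2 * R) * (1 / ((l : ℝ) + 1) ^ 2) := by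
  have h0 : z + (l + 1) ≠ 0 := Complex.slitPlane_ne_zero (natCast_add_mem_slitPlane_of_re hz l)
  have hl : (l : ℂ) + 1 ≠ 0 := by exact_mod_cast l.succ_ne_zero
  have e : ((Real.log (l + 1) - Real.log l : ℝ) : ℂ) - 1 / (z + (l + 1))
      = ((Real.log (l + 1) - Real.log l - 1 / (l + 1) : ℝ) : ℂ) + z / ((z + (l + 1)) * (l + 1)) := by
    push_cast
    field_simp
    ring
  have h1 : ((l : ℝ) + 1) / 2 ≤ ‖z + (l + 1)‖ := by
    refine le_trans ?_ (Complex.re_le_norm _)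
    simp
    have : (0 : ℝ) ≤ l := by positivity
    linarith
  have hn : ‖(l : ℂ) + 1‖ = (l : ℝ) + 1 := by
    have := Complex.norm_natCast (l + 1)
    push_cast at this
    exact this
  have h2 : ‖z / ((z + (l + 1)) * (l + 1))‖ ≤ 2 * R * (1 / ((l : ℝ) + 1) ^ 2) := by
    rw [norm_div, norm_mul, hn]
    calc ‖z‖ / (‖z + (l + 1)‖ * (l + 1)) ≤ R / ((((l : ℝ) + 1) / 2) * (l + 1)) := by
          have := norm_nonneg z
          gcongr
          linarith
      _ = _ := by field_simp
  rw [e]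
  refine (norm_add_le _ _).trans ?_
  rw [Complex.norm_real, Real.norm_eq_abs]
  have := abs_log_step_sub_le l
  linarith

theorem summable_one_div_nat_succ_sq : Summable fun l : ℕ => 1 / ((l : ℝ) + 1) ^ 2 := by
  have := (summable_nat_add_iff 1).2 (Real.summable_one_div_nat_pow.2 (le_refl 2))
  simpa using this

theorem logGammaTerm_zero (l : ℕ) : logGammaTerm l 0 = 0 := by
  simp only [logGammaTerm, zero_add, zero_mul, add_zero]
  rw [← Complex.ofReal_natCast, ← Complex.ofReal_one, ← Complex.ofReal_add,
    ← Complex.ofReal_log (by positivity), sub_self]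

theorem hasDerivAt_tsum_logGammaTerm {z : ℂ} (hz : -(1 / 2) < z.re) :
    Summable (fun l => logGammaTerm l z) ∧
    HasDerivAt (fun w => ∑' l, logGammaTerm l w)
      (∑' l : ℕ, (((Real.log (l + 1) - Real.log l : ℝ) : ℂ) - 1 / (z + (l + 1)))) z := by
  set t : Set ℂ := {w : ℂ | -(1 / 2) < w.re} ∩ Metric.ball 0 (‖z‖ + 1)
  have ho : IsOpen t := (isOpen_lt continuous_const Complex.continuous_re).inter Metric.isOpen_ball
  have hc : Convex ℝ t := (convex_halfSpace_re_gt _).inter (convex_ball _ _)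
  have hu : Summable fun l : ℕ => (4 + 2 * (‖z‖ + 1)) * (1 / ((l : ℝ) + 1) ^ 2) :=
    summable_one_div_nat_succ_sq.mul_left _
  have h0 : (0 : ℂ) ∈ t := ⟨by simp, by simp; positivity⟩
  have hzt : z ∈ t := ⟨hz, by simp⟩
  have hg : ∀ (n : ℕ) (y : ℂ), y ∈ t → HasDerivAt (logGammaTerm n)
      (((Real.log (n + 1) - Real.log n : ℝ) : ℂ) - 1 / (y + (n + 1))) y :=
    fun n y hy => hasDerivAt_logGammaTerm hy.1 n
  have hg' : ∀ (n : ℕ) (y : ℂ), y ∈ t →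
      ‖((Real.log (n + 1) - Real.log n : ℝ) : ℂ) - 1 / (y + (n + 1))‖
        ≤ (4 + 2 * (‖z‖ + 1)) * (1 / ((n : ℝ) + 1) ^ 2) :=
    fun n y hy => norm_logGammaTerm_deriv_le hy.1 (by simpa using (mem_ball_zero_iff.1 hy.2).le) n
  have hs : Summable fun l => logGammaTerm l 0 := by simp [logGammaTerm_zero, summable_zero]
  exact ⟨summable_of_summable_hasDerivAt_of_isPreconnected hu ho hc.isPreconnected hg hg' h0 hs hzt,
    hasDerivAt_tsum_of_isPreconnected hu ho hc.isPreconnected hg hg' h0 hs hzt⟩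

/-- The partial sums are logarithms of Euler's product n! n^z / ((z+1)⋯(z+n)); the increments of the
real logarithm telescope to z log n. -/
theorem exp_sum_logGammaTerm {z : ℂ} (hz : -(1 / 2) < z.re) (h : z ≠ 0) (n : ℕ) (hn : n ≠ 0) :
    z * Complex.GammaSeq z n = Complex.exp (∑ l ∈ Finset.range n, logGammaTerm l z) := by
  have hsum : ∑ l ∈ Finset.range n, logGammaTerm l z
      = ∑ l ∈ Finset.range n, ((Real.log (l + 1) : ℂ) - Complex.log (z + (l + 1)))
        + z * (Real.log n : ℂ) := by
    simp only [logGammaTerm]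
    rw [Finset.sum_add_distrib, ← Finset.mul_sum, ← Complex.ofReal_sum]
    congr 3
    have := Finset.sum_range_sub (fun i : ℕ => Real.log i) n
    simpa using this
  have hf : Complex.exp (∑ l ∈ Finset.range n, ((Real.log (l + 1) : ℂ) - Complex.log (z + (l + 1))))
      = (n.factorial : ℂ) / ∏ l ∈ Finset.range n, (z + (l + 1)) := by
    rw [Complex.exp_sum, ← Finset.prod_range_add_one_eq_factorial, Nat.cast_prod, ← Finset.prod_div_distrib]
    refine Finset.prod_congr rfl fun l _ => ?_
    rw [Complex.exp_sub, Complex.exp_log (Complex.slitPlane_ne_zero (natCast_add_mem_slitPlane_of_re hz l)),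
      ← Complex.ofReal_exp, Real.exp_log (by positivity)]
    push_cast
    rfl
  rw [hsum, Complex.exp_add, hf, Complex.GammaSeq, Finset.prod_range_succ',
    Complex.cpow_def_of_ne_zero (by exact_mod_cast hn), Complex.natCast_log]
  push_cast
  rw [mul_comm z (Complex.log n)]
  simp only [add_zero]
  rw [← mul_div_assoc, mul_comm z, mul_div_mul_right _ _ h]
  ring

theorem exp_tsum_logGammaTerm {z : ℂ} (hz : -(1 / 2) < z.re) :
    Complex.exp (∑' l, logGammaTerm l z) = Complex.Gamma (z + 1) := by
  by_cases h : z = 0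
  · simp [h, logGammaTerm_zero]
  have h1 := (hasDerivAt_tsum_logGammaTerm hz).1.hasSum.tendsto_sum_nat.cexp
  have h2 := (Complex.GammaSeq_tendsto_Gamma z).const_mul z
  rw [Complex.Gamma_add_one z h]
  refine tendsto_nhds_unique h1 (h2.congr' ?_)
  filter_upwards [Filter.eventually_ne_atTop 0] with n hn
  rw [exp_sum_logGammaTerm hz h n hn]

/-- Near z, Γ(w + 1) is the exponential of the series, so its logarithmic derivative is the termwise
derivative. -/
theorem hasSum_digamma_of_re {z : ℂ} (hz : -(1 / 2) < z.re) :
    HasSum (fun l : ℕ => ((Real.log (l + 1) - Real.log l : ℝ) : ℂ) - 1 / (z + (l + 1)))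
      (Complex.digamma (z + 1)) := by
  have h1 := (hasDerivAt_tsum_logGammaTerm hz).2
  have h2 := h1.cexp
  have ho : ∀ᶠ w in nhds z, -(1 / 2) < w.re :=
    (isOpen_lt continuous_const Complex.continuous_re).mem_nhds hz
  have h3 : HasDerivAt (fun w => Complex.Gamma (w + 1)) _ z :=
    h2.congr_of_eventuallyEq (by
      filter_upwards [ho] with w hw
      rw [exp_tsum_logGammaTerm hw])
  have h4 := h3.deriv
  rw [deriv_comp_add_const, exp_tsum_logGammaTerm hz] at h4
  have hG : Complex.Gamma (z + 1) ≠ 0 := by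
    rw [← exp_tsum_logGammaTerm hz]
    exact Complex.exp_ne_zero _
  rw [Complex.digamma_def, logDeriv_apply, h4, mul_div_cancel_left₀ _ hG]
  exact (Summable.of_norm_bounded (summable_one_div_nat_succ_sq.mul_left _)
    (norm_logGammaTerm_deriv_le hz le_rfl)).hasSum

theorem add_one_mem_slitPlane {z : ℂ} (hz : z ∈ Complex.slitPlane) : z + 1 ∈ Complex.slitPlane := by
  simpa using add_natCast_mem_slitPlane hz 1

theorem add_natCast_succ_mem_slitPlane {z : ℂ} (hz : z ∈ Complex.slitPlane) (l : ℕ) :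
    z + (l + 1) ∈ Complex.slitPlane := by
  simpa using add_natCast_mem_slitPlane hz (l + 1)

theorem add_natCast_succ_ne_zero {z : ℂ} (hz : z ∈ Complex.slitPlane) (l : ℕ) :
    z + (l + 1) ≠ 0 :=
  Complex.slitPlane_ne_zero (add_natCast_succ_mem_slitPlane hz l)

theorem digamma_add_one_of_mem_slitPlane {z : ℂ} (hz : z ∈ Complex.slitPlane) :
    Complex.digamma (z + 1) = Complex.digamma z + 1 / z := by
  rw [one_div]
  refine Complex.digamma_apply_add_one z fun m h => ?_
  have := add_natCast_mem_slitPlane hz m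
  rw [h, neg_add_cancel] at this
  exact Complex.slitPlane_ne_zero this rfl

theorem tendsto_one_div_add_natCast (z : ℂ) :
    Filter.Tendsto (fun n : ℕ => 1 / (z + (n + 1))) Filter.atTop (nhds 0) := by
  simp only [one_div]
  refine Filter.tendsto_inv₀_cobounded.comp (tendsto_norm_atTop_iff_cobounded.1 ?_)
  refine Filter.tendsto_atTop_mono (f := fun n : ℕ => (n : ℝ) + (-‖z + 1‖)) (fun n => ?_)
    (Filter.tendsto_atTop_add_const_right _ _ tendsto_natCast_atTop_atTop)
  have h := norm_sub_norm_le (n : ℂ) (-(z + 1))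
  rw [norm_neg, Complex.norm_natCast] at h
  rw [show z + ((n : ℂ) + 1) = n - -(z + 1) by ring]
  linarith

/-- The recurrence for ψ carries the limit from the half-plane to the whole slit plane, one unit to
the left per induction step. -/
theorem tendsto_digamma {z : ℂ} (hz : z ∈ Complex.slitPlane) :
    Filter.Tendsto (fun n : ℕ => (Real.log n : ℂ) - ∑ l ∈ Finset.range n, 1 / (z + (l + 1)))
      Filter.atTop (nhds (Complex.digamma (z + 1))) := by
  obtain ⟨m, hm⟩ := exists_nat_gt (-z.re)
  induction m generalizing z with
  | zero =>
    have h := (hasSum_digamma_of_re (z := z) (by simp at hm; linarith)).tendsto_sum_nat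
    refine h.congr fun n => ?_
    rw [Finset.sum_sub_distrib, ← Complex.ofReal_sum]
    congr 2
    have := Finset.sum_range_sub (fun i : ℕ => Real.log i) n
    simpa using this
  | succ m ih =>
    have hz1 := add_one_mem_slitPlane hz
    have h := ih hz1 (by simp; push_cast at hm; linarith)
    rw [digamma_add_one_of_mem_slitPlane hz1] at h
    -- Shifting z by 1 drops the first summand 1/(z + 1) and adds one at the far end that tends to
    -- 0.
    have h' := (h.sub_const (1 / (z + 1))).add (tendsto_one_div_add_natCast z)
    rw [add_sub_cancel_right, add_zero] at h'
    refine h'.congr fun n => ?_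
    have e1 := Finset.sum_range_succ' (fun l : ℕ => 1 / (z + ((l : ℂ) + 1))) n
    have e2 := Finset.sum_range_succ (fun l : ℕ => 1 / (z + ((l : ℂ) + 1))) n
    have e3 : ∑ l ∈ Finset.range n, 1 / (z + 1 + ((l : ℂ) + 1))
        = ∑ l ∈ Finset.range n, 1 / (z + (((l + 1 : ℕ) : ℂ) + 1)) := by
      refine Finset.sum_congr rfl fun l _ => ?_
      push_cast
      ring_nf
    rw [e3]
    simp only [Nat.cast_zero, zero_add] at e1
    linear_combination e1 - e2

theorem tendsto_sum_one_div_sub_log :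
    Filter.Tendsto (fun n : ℕ => ∑ l ∈ Finset.range n, 1 / ((l : ℂ) + 1) - (Real.log n : ℂ))
      Filter.atTop (nhds (Real.eulerMascheroniConstant : ℂ)) := by
  have h := (Complex.continuous_ofReal.tendsto _).comp Real.tendsto_harmonic_sub_log
  refine h.congr fun n => ?_
  simp [harmonic]

theorem norm_natCast_succ (l : ℕ) : ‖(l : ℂ) + 1‖ = (l : ℝ) + 1 := by
  have := Complex.norm_natCast (l + 1)
  push_cast at this
  exact this

theorem natCast_succ_ne_zero (l : ℕ) : (l : ℂ) + 1 ≠ 0 := by exact_mod_cast l.succ_ne_zero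

theorem SectorBound.norm_one_div_sub_le {c : ℝ} {z : ℂ} (h : SectorBound c z) (hc : 0 < c)
    (hz : z ∈ Complex.slitPlane) (l : ℕ) :
    ‖1 / ((l : ℂ) + 1) - 1 / (z + (l + 1))‖ ≤ ‖z‖ / (c * ((l + 1) * (‖z‖ + (l + 1)))) := by
  have h1 := h (l + 1) (by positivity)
  push_cast at h1
  rw [div_sub_div _ _ (natCast_succ_ne_zero l) (add_natCast_succ_ne_zero hz l), norm_div, norm_mul,
    norm_natCast_succ]
  have e : 1 * (z + ((l : ℂ) + 1)) - (l + 1) * 1 = z := by ring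
  rw [e]
  have hn : 0 < ‖z‖ := norm_pos_iff.2 (Complex.slitPlane_ne_zero hz)
  calc _ ≤ ‖z‖ / ((l + 1) * (c * (‖z‖ + (l + 1)))) := by gcongr
    _ = _ := by ring_nf

/-- The partial fraction expansion of the digamma function. -/
theorem hasSum_digamma {z : ℂ} (hz : z ∈ Complex.slitPlane) :
    HasSum (fun l : ℕ => 1 / ((l : ℂ) + 1) - 1 / (z + (l + 1)))
      (Complex.digamma (z + 1) + Real.eulerMascheroniConstant) := by
  obtain ⟨c, hc, h⟩ := exists_sectorBound hz
  have hs : Summable (fun l : ℕ => 1 / ((l : ℂ) + 1) - 1 / (z + (l + 1))) := by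
    refine Summable.of_norm_bounded (summable_one_div_nat_succ_sq.mul_left (‖z‖ / c)) fun l => ?_
    refine (h.norm_one_div_sub_le hc hz l).trans ?_
    have hn : 0 < ‖z‖ := norm_pos_iff.2 (Complex.slitPlane_ne_zero hz)
    calc _ ≤ ‖z‖ / (c * ((l + 1) * (0 + (l + 1)))) := by gcongr
      _ = _ := by field_simp; ring
  rw [hs.hasSum_iff_tendsto_nat]
  refine ((tendsto_digamma hz).add tendsto_sum_one_div_sub_log).congr fun n => ?_
  rw [Finset.sum_sub_distrib]
  ring

/-! ### Comparison of ψ(z + 1) with log z, and convergence of the Herglotz series. -/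

/-- The mean value inequality on [0, 1] gives 1 / (c² (‖z‖+l)(‖z‖+l+1)), written as a difference so
that it telescopes over l. -/
theorem SectorBound.norm_log_step_le {c : ℝ} {z : ℂ} (h : SectorBound c z) (hc : 0 < c)
    (hz : z ∈ Complex.slitPlane) (l : ℕ) :
    ‖Complex.log (z + (l + 1)) - Complex.log (z + l) - 1 / (z + (l + 1))‖
      ≤ (1 / c ^ 2) * (1 / (‖z‖ + l) - 1 / (‖z‖ + (l + 1))) := by
  have hn : 0 < ‖z‖ := norm_pos_iff.2 (Complex.slitPlane_ne_zero hz)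
  have hl : (0 : ℝ) ≤ l := by positivity
  have hmem : ∀ u : ℝ, 0 ≤ u → z + l + u ∈ Complex.slitPlane := fun u hu =>
    add_ofReal_mem_slitPlane (add_natCast_mem_slitPlane hz l) hu
  have hd : ∀ u ∈ Set.Icc (0 : ℝ) 1, HasDerivWithinAt
      (fun u : ℝ => Complex.log (z + l + u) - (u : ℂ) * (1 / (z + (l + 1))))
      (1 / (z + l + u) - 1 / (z + (l + 1))) (Set.Icc 0 1) u := by
    intro u hu
    have h1 : HasDerivAt (fun u : ℝ => z + l + (u : ℂ)) 1 u :=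
      (Complex.ofRealCLM.hasDerivAt (x := u)).const_add (z + l)
    have h2 := (h1.clog_real (hmem u hu.1)).sub
      ((Complex.ofRealCLM.hasDerivAt (x := u)).mul_const (1 / (z + (l + 1))))
    refine (h2.congr_deriv ?_).hasDerivWithinAt
    simp
  have hb : ∀ u ∈ Set.Ico (0 : ℝ) 1, ‖1 / (z + l + u) - 1 / (z + (l + 1))‖
      ≤ (1 / c ^ 2) * (1 / (‖z‖ + l) - 1 / (‖z‖ + (l + 1))) := by
    intro u hu
    have h1 := h (l + u) (by linarith [hu.1])
    have h2 := h (l + 1) (by positivity)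
    push_cast at h1 h2
    rw [← add_assoc, ← add_assoc] at h1
    rw [div_sub_div _ _ (Complex.slitPlane_ne_zero (hmem u hu.1)) (add_natCast_succ_ne_zero hz l),
      norm_div, norm_mul]
    have e : 1 * (z + ((l : ℂ) + 1)) - (z + l + u) * 1 = ((1 - u : ℝ) : ℂ) := by
      push_cast
      ring
    rw [e, Complex.norm_of_nonneg (by linarith [hu.2])]
    calc (1 - u) / (‖z + l + u‖ * ‖z + (l + 1)‖)
        ≤ 1 / ((c * (‖z‖ + l)) * (c * (‖z‖ + (l + 1)))) := by
          have : c * (‖z‖ + l) ≤ ‖z + l + u‖ := by nlinarith [mul_nonneg hc.le hu.1]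
          gcongr
          linarith [hu.1]
      _ = _ := by
        field_simp
        ring
  have := norm_image_sub_le_of_norm_deriv_le_segment_01' hd hb
  simp only [Complex.ofReal_one, Complex.ofReal_zero, zero_mul, sub_zero, one_mul, add_zero] at this
  rw [show z + ((l : ℂ) + 1) = z + l + 1 by ring] at this ⊢
  rw [sub_right_comm]
  exact this

theorem tendsto_log_natCast_sub_log_add {z : ℂ} :
    Filter.Tendsto (fun n : ℕ => (Real.log n : ℂ) - Complex.log (z + n))
      Filter.atTop (nhds 0) := by
  have h1 : Filter.Tendsto (fun n : ℕ => 1 + z * (n : ℂ)⁻¹) Filter.atTop (nhds (1 + z * 0)) :=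
    (tendsto_inv_atTop_nhds_zero_nat (𝕜 := ℂ)).const_mul z |>.const_add 1
  rw [mul_zero, add_zero] at h1
  have h2 := h1.clog (by simp)
  rw [Complex.log_one] at h2
  have h3 := h2.neg
  rw [neg_zero] at h3
  refine h3.congr' ?_
  filter_upwards [Filter.eventually_gt_atTop 0, h1.eventually_ne one_ne_zero] with n hn hne
  have hn' : (n : ℂ) ≠ 0 := by exact_mod_cast hn.ne'
  have e : z + n = ((n : ℝ) : ℂ) * (1 + z * (n : ℂ)⁻¹) := by
    push_cast
    field_simp
    ring
  rw [e, Complex.log_ofReal_mul (by exact_mod_cast hn) hne]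
  ring

theorem SectorBound.norm_digamma_sub_log_le {c : ℝ} {z : ℂ} (h : SectorBound c z) (hc : 0 < c)
    (hz : z ∈ Complex.slitPlane) :
    ‖Complex.digamma (z + 1) - Complex.log z‖ ≤ 1 / (c ^ 2 * ‖z‖) := by
  have hn : 0 < ‖z‖ := norm_pos_iff.2 (Complex.slitPlane_ne_zero hz)
  have h1 := ((tendsto_digamma hz).sub_const (Complex.log z)).sub
    (tendsto_log_natCast_sub_log_add (z := z))
  rw [sub_zero] at h1
  refine le_of_tendsto h1.norm (Filter.Eventually.of_forall fun n => ?_)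
  have e1 := Finset.sum_range_sub (fun i : ℕ => Complex.log (z + i)) n
  have e2 := Finset.sum_range_sub' (fun i : ℕ => 1 / (‖z‖ + (i : ℝ))) n
  have e : (Real.log n : ℂ) - ∑ l ∈ Finset.range n, 1 / (z + ((l : ℂ) + 1)) - Complex.log z
      - ((Real.log n : ℂ) - Complex.log (z + n))
      = ∑ l ∈ Finset.range n,
        (Complex.log (z + (l + 1)) - Complex.log (z + l) - 1 / (z + (l + 1))) := by
    rw [Finset.sum_sub_distrib]
    push_cast at e1
    rw [e1]
    simp
    ring
  rw [e]
  refine (norm_sum_le_of_le _ fun l _ => h.norm_log_step_le hc hz l).trans ?_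
  rw [← Finset.mul_sum]
  push_cast at e2
  rw [e2]
  have : 0 ≤ 1 / (‖z‖ + (n : ℝ)) := by positivity
  calc _ ≤ 1 / c ^ 2 * (1 / ‖z‖) := by
        gcongr
        simpa using this
    _ = _ := by field_simp

theorem sum_range_one_div_add {z : ℂ} (hz : z ∈ Complex.slitPlane) (X : ℕ) :
    ∑ n ∈ Finset.range X, 1 / (((n : ℂ) + 1) + z)
      = Complex.digamma (z + X + 1) - Complex.digamma (z + 1) := by
  induction X with
  | zero => simp
  | succ X ih =>
    rw [Finset.sum_range_succ, ih, Nat.cast_succ, ← add_assoc,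
      digamma_add_one_of_mem_slitPlane (add_one_mem_slitPlane (add_natCast_mem_slitPlane hz X))]
    rw [show ((X : ℂ) + 1) + z = z + X + 1 by ring]
    ring

theorem summable_one_div_succ_rpow {p : ℝ} (hp : 1 < p) :
    Summable fun n : ℕ => 1 / ((n : ℝ) + 1) ^ p := by
  have := (summable_nat_add_iff 1).2 (Real.summable_one_div_nat_rpow.2 hp)
  simpa using this

theorem succ_rpow_pos (n : ℕ) (p : ℝ) : 0 < ((n : ℝ) + 1) ^ p := by positivity

theorem SectorBound.norm_digamma_sub_log_smul_le {c t : ℝ} {z : ℂ} (h : SectorBound c z)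
    (hc : 0 < c) (hz : z ∈ Complex.slitPlane) (ht : 0 < t) :
    ‖Complex.digamma (t * z + 1) - Complex.log (t * z)‖ ≤ 1 / (c ^ 2 * ‖z‖) * (1 / t) := by
  refine ((h.smul ht).norm_digamma_sub_log_le hc (ofReal_mul_mem_slitPlane hz ht)).trans
    (le_of_eq ?_)
  rw [norm_mul, Complex.norm_of_nonneg ht.le]
  field_simp

/-- The defining series of the extended higher Herglotz function with `ψ(z)` replaced by
`ψ(z + 1)`. -/
theorem summable_digamma_add_one_sub_log {k N : ℝ} (hkN : 1 < k + N) {x : ℂ}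
    (hx : x ∈ Complex.slitPlane) :
    Summable fun n : ℕ => (Complex.digamma (((((n : ℝ) + 1) ^ N : ℝ) : ℂ) * x + 1)
      - Complex.log (((((n : ℝ) + 1) ^ N : ℝ) : ℂ) * x)) / ((((n : ℝ) + 1) ^ k : ℝ) : ℂ) := by
  obtain ⟨c, hc, h⟩ := exists_sectorBound hx
  refine Summable.of_norm_bounded
    ((summable_one_div_succ_rpow hkN).mul_left (1 / (c ^ 2 * ‖x‖))) fun n => ?_
  rw [norm_div, Complex.norm_of_nonneg (succ_rpow_pos n k).le]
  have := h.norm_digamma_sub_log_smul_le hc hx (succ_rpow_pos n N)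
  calc _ ≤ (1 / (c ^ 2 * ‖x‖) * (1 / ((n : ℝ) + 1) ^ N)) / ((n : ℝ) + 1) ^ k := by
        have := succ_rpow_pos n k
        gcongr
    _ = _ := by
      rw [Real.rpow_add (by positivity)]
      field_simp

/-- By ψ(z) = ψ(z+1) - 1/z; the split-off terms sum to ζ(k+N)/x, and ψ(z+1) is what the partial
fractions describe. -/
theorem herglotzTerm_eq {k N : ℝ} {x : ℂ} (hx : x ∈ Complex.slitPlane) (n : ℕ) :
    herglotzTerm k N x n
      = (Complex.digamma (((((n : ℝ) + 1) ^ N : ℝ) : ℂ) * x + 1)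
        - Complex.log (((((n : ℝ) + 1) ^ N : ℝ) : ℂ) * x)) / ((((n : ℝ) + 1) ^ k : ℝ) : ℂ)
        - ((1 / ((n : ℝ) + 1) ^ (k + N) : ℝ) : ℂ) / x := by
  have h1 : ((((n : ℝ) + 1) ^ N : ℝ) : ℂ) ≠ 0 := by exact_mod_cast (succ_rpow_pos n N).ne'
  have h2 : ((((n : ℝ) + 1) ^ k : ℝ) : ℂ) ≠ 0 := by exact_mod_cast (succ_rpow_pos n k).ne'
  have h0 := Complex.slitPlane_ne_zero hx
  rw [herglotzTerm, digamma_add_one_of_mem_slitPlane (ofReal_mul_mem_slitPlane hx (succ_rpow_pos n N)),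
    Real.rpow_add (by positivity)]
  push_cast
  field_simp
  ring

theorem summable_herglotzTerm {k N : ℝ} (hkN : 1 < k + N) {x : ℂ} (hx : x ∈ Complex.slitPlane) :
    Summable (herglotzTerm k N x) := by
  have h1 := (Complex.ofRealCLM.summable (summable_one_div_succ_rpow hkN)).div_const x
  refine ((summable_digamma_add_one_sub_log hkN hx).sub h1).congr fun n => ?_
  rw [herglotzTerm_eq hx]
  rfl

theorem hasSum_one_div_succ_rpow {p : ℝ} (hp : 1 < p) :
    HasSum (fun n : ℕ => ((1 / ((n : ℝ) + 1) ^ p : ℝ) : ℂ)) (riemannZeta p) := by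
  have h := Complex.ofRealCLM.summable (summable_one_div_succ_rpow hp)
  rw [zeta_eq_tsum_one_div_nat_add_one_cpow (by simpa using hp)]
  have e : ∀ n : ℕ, ((1 / ((n : ℝ) + 1) ^ p : ℝ) : ℂ) = 1 / ((n : ℂ) + 1) ^ (p : ℂ) := by
    intro n
    rw [Complex.ofReal_div, Complex.ofReal_cpow (by positivity)]
    push_cast
    rfl
  simp only [Complex.ofRealCLM_apply, e] at h ⊢
  exact h.hasSum

/-- The Herglotz function in terms of `ψ(z + 1)`. -/
theorem extHerglotz_eq {k N : ℝ} (hkN : 1 < k + N) {x : ℂ} (hx : x ∈ Complex.slitPlane) :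
    extHerglotz k N x = (∑' n : ℕ, (Complex.digamma (((((n : ℝ) + 1) ^ N : ℝ) : ℂ) * x + 1)
        - Complex.log (((((n : ℝ) + 1) ^ N : ℝ) : ℂ) * x)) / ((((n : ℝ) + 1) ^ k : ℝ) : ℂ))
        - riemannZeta ((k + N : ℝ) : ℂ) / x := by
  have h1 := (hasSum_one_div_succ_rpow hkN).div_const x
  rw [extHerglotz, ← h1.tsum_eq, ← (summable_digamma_add_one_sub_log hkN hx).tsum_sub h1.summable]
  exact tsum_congr fun n => herglotzTerm_eq hx n

/-! ### Sums over the roots ω_j = e^{-iπj/N}. -/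

theorem sum_dprimeIndex {M : Type*} [AddCommMonoid M] (N : ℕ) (f : ℤ → M) :
    ∑ j ∈ dprimeIndex N, f j = ∑ m ∈ Finset.range N, f (2 * (m : ℤ) - ((N : ℤ) - 1)) := by
  rw [dprimeIndex, Finset.sum_image]
  intro a _ b _ h
  simp only at h
  omega

theorem abs_lt_of_mem_dprimeIndex {N : ℕ} {j : ℤ} (hj : j ∈ dprimeIndex N) : |j| < N := by
  simp only [dprimeIndex, Finset.mem_image, Finset.mem_range] at hj
  obtain ⟨m, hm, rfl⟩ := hj
  rw [abs_lt]
  omega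

/-- The `p`-th power of `e^{-iπj/N}`. -/
noncomputable def twistRoot (N : ℕ) (p j : ℤ) : ℂ :=
  Complex.exp (-(Complex.I * Real.pi * (j : ℂ) * (p : ℂ) / (N : ℂ)))

theorem twistRoot_add (N : ℕ) (p q j : ℤ) :
    twistRoot N (p + q) j = twistRoot N p j * twistRoot N q j := by
  rw [twistRoot, twistRoot, twistRoot, ← Complex.exp_add]
  congr 1
  push_cast
  ring

theorem twistRoot_zero (N : ℕ) (j : ℤ) : twistRoot N 0 j = 1 := by simp [twistRoot]

theorem twistRoot_one_pow (N : ℕ) (j : ℤ) (i : ℕ) : twistRoot N 1 j ^ i = twistRoot N i j := by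
  rw [twistRoot, twistRoot, ← Complex.exp_nat_mul]
  congr 1
  push_cast
  ring

theorem twistRoot_index (N : ℕ) (hN : N ≠ 0) (p : ℤ) (m : ℕ) :
    twistRoot N p (2 * (m : ℤ) - ((N : ℤ) - 1))
      = Complex.exp (Complex.I * Real.pi * (N - 1) * p / N)
        * Complex.exp (-(2 * Real.pi * Complex.I * p / N)) ^ m := by
  rw [twistRoot, ← Complex.exp_nat_mul, ← Complex.exp_add]
  congr 1
  have : (N : ℂ) ≠ 0 := by exact_mod_cast hN
  push_cast
  field_simp
  ring

theorem exp_twist_pow (N : ℕ) (hN : N ≠ 0) (p : ℤ) :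
    Complex.exp (-(2 * Real.pi * Complex.I * p / N)) ^ N = 1 := by
  have : (N : ℂ) ≠ 0 := by exact_mod_cast hN
  rw [← Complex.exp_nat_mul, Complex.exp_eq_one_iff]
  refine ⟨-p, ?_⟩
  push_cast
  field_simp

theorem exp_twist_ne_one {N : ℕ} (hN : N ≠ 0) {p : ℤ} (hp : ¬ (N : ℤ) ∣ p) :
    Complex.exp (-(2 * Real.pi * Complex.I * p / N)) ≠ 1 := by
  have hN' : (N : ℂ) ≠ 0 := by exact_mod_cast hN
  intro h
  obtain ⟨n, hn⟩ := Complex.exp_eq_one_iff.1 h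
  apply hp
  refine ⟨-n, ?_⟩
  have hpi := Complex.two_pi_I_ne_zero
  have : (2 * Real.pi * Complex.I) * (p : ℂ) = (2 * Real.pi * Complex.I) * (N * -n) := by
    field_simp at hn
    linear_combination (-Complex.I * 2 * Real.pi) * hn
  have := mul_left_cancel₀ hpi this
  exact_mod_cast this

/-- A full geometric sum of an N-th root of unity other than 1. This orthogonality removes every
contribution independent of j. -/
theorem sum_twistRoot_eq_zero {N : ℕ} (hN : N ≠ 0) {p : ℤ} (hp : ¬ (N : ℤ) ∣ p) :
    ∑ j ∈ dprimeIndex N, twistRoot N p j = 0 := by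
  rw [sum_dprimeIndex]
  simp only [twistRoot_index N hN, ← Finset.mul_sum]
  rw [geom_sum_eq (exp_twist_ne_one hN hp), exp_twist_pow N hN]
  simp

theorem card_dprimeIndex (N : ℕ) : (dprimeIndex N).card = N := by
  have := sum_dprimeIndex N (fun _ => 1)
  simpa using this

/-- Every index j has the parity of N - 1. -/
theorem twistRoot_natCast_self {N : ℕ} (hN : N ≠ 0) {j : ℤ} (hj : j ∈ dprimeIndex N) :
    twistRoot N N j = (-1) ^ (N - 1) := by
  simp only [dprimeIndex, Finset.mem_image, Finset.mem_range] at hj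
  obtain ⟨m, hm, rfl⟩ := hj
  have hN' : (N : ℂ) ≠ 0 := by exact_mod_cast hN
  rw [twistRoot_index N hN, ← Complex.exp_pi_mul_I, ← Complex.exp_nat_mul, ← Complex.exp_nat_mul,
    ← Complex.exp_add, Complex.exp_eq_exp_iff_exists_int]
  refine ⟨-m, ?_⟩
  rw [Nat.cast_sub (Nat.one_le_iff_ne_zero.2 hN)]
  push_cast
  field_simp

theorem twistRoot_neg_natCast_self {N : ℕ} (hN : N ≠ 0) {j : ℤ} (hj : j ∈ dprimeIndex N) :
    twistRoot N (-N) j = (-1) ^ (N - 1) := by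
  have h := twistRoot_add N N (-N) j
  rw [add_neg_cancel, twistRoot_zero, twistRoot_natCast_self hN hj] at h
  rcases neg_one_pow_eq_or ℂ (N - 1) with e | e <;> rw [e] at h ⊢
  · simpa using h.symm
  · linear_combination h

theorem sub_one_mul_sum_natCast_mul_pow (z : ℂ) (n : ℕ) :
    (z - 1) * ∑ m ∈ Finset.range n, (m : ℂ) * z ^ m
      = n * z ^ n - z * ∑ m ∈ Finset.range n, z ^ m := by
  induction n with
  | zero => simp
  | succ n ih =>
    rw [Finset.sum_range_succ, Finset.sum_range_succ, mul_add, ih]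
    push_cast
    ring

theorem sum_natCast_mul_pow_of_pow_eq_one {z : ℂ} {N : ℕ} (hz : z ≠ 1) (h : z ^ N = 1) :
    ∑ m ∈ Finset.range N, (m : ℂ) * z ^ m = N / (z - 1) := by
  have h1 := sub_one_mul_sum_natCast_mul_pow z N
  have hz' : z - 1 ≠ 0 := sub_ne_zero.2 hz
  rw [geom_sum_eq hz, h] at h1
  rw [eq_div_iff hz', mul_comm, h1]
  simp

/-- With j = 2m - (N-1) the constant part drops out by orthogonality, and ∑ m z^m = N/(z - 1). -/
theorem sum_mul_twistRoot_neg {N : ℕ} (hN : N ≠ 0) {p : ℕ} (hp : ¬ (N : ℤ) ∣ p) :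
    ∑ j ∈ dprimeIndex N, (j : ℂ) * twistRoot N (-p) j
      = (-1) ^ p * N / (Complex.I * Complex.sin (Real.pi / N * p)) := by
  have hN' : (N : ℂ) ≠ 0 := by exact_mod_cast hN
  have hp' : ¬ (N : ℤ) ∣ -(p : ℤ) := by simpa using hp
  set z := Complex.exp (-(2 * Real.pi * Complex.I * ((-(p : ℤ) : ℤ) : ℂ) / N)) with hz
  set b := Complex.exp (Complex.I * Real.pi * (N - 1) * ((-(p : ℤ) : ℤ) : ℂ) / N) with hb
  have hz1 : z ≠ 1 := exp_twist_ne_one hN hp'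
  have hzN : z ^ N = 1 := exp_twist_pow N hN _
  have h1 : ∑ j ∈ dprimeIndex N, (j : ℂ) * twistRoot N (-p) j
      = 2 * b * ∑ m ∈ Finset.range N, (m : ℂ) * z ^ m
        - (N - 1) * ∑ j ∈ dprimeIndex N, twistRoot N (-p) j := by
    rw [sum_dprimeIndex, sum_dprimeIndex, Finset.mul_sum, Finset.mul_sum, ← Finset.sum_sub_distrib]
    refine Finset.sum_congr rfl fun m _ => ?_
    rw [twistRoot_index N hN]
    push_cast at hz hb ⊢
    rw [← hz, ← hb]
    ring
  rw [h1, sum_twistRoot_eq_zero hN hp', sum_natCast_mul_pow_of_pow_eq_one hz1 hzN]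
  -- The half-angle root u, with z = u², turns z - 1 into a sine.
  set u := Complex.exp (Complex.I * (Real.pi / N * p)) with hu
  have hu0 : u ≠ 0 := Complex.exp_ne_zero _
  have ez : z = u ^ 2 := by
    rw [hz, hu, ← Complex.exp_nat_mul]
    congr 1
    push_cast
    ring
  have eb : b = (-1) ^ p * u := by
    have : ((-1 : ℂ)) ^ p = Complex.exp (-(Real.pi * Complex.I * p)) := by
      rw [show -(Real.pi * Complex.I * (p : ℂ)) = p * (-(Real.pi * Complex.I)) by ring,
        Complex.exp_nat_mul, Complex.exp_neg, Complex.exp_pi_mul_I]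
      norm_num
    rw [this, hb, hu, ← Complex.exp_add]
    congr 1
    push_cast
    field_simp
    ring
  have es : Complex.I * Complex.sin (Real.pi / N * p) = (u - u⁻¹) / 2 := by
    rw [Complex.sin, hu, ← Complex.exp_neg]
    rw [show -(Real.pi / (N : ℂ) * p) * Complex.I = -(Complex.I * (Real.pi / N * p)) by ring,
      show (Real.pi / (N : ℂ) * p) * Complex.I = Complex.I * (Real.pi / N * p) by ring]
    linear_combination ((Complex.exp (-(Complex.I * (Real.pi / N * p)))
      - Complex.exp (Complex.I * (Real.pi / N * p))) / 2) * Complex.I_sq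
  rw [es, eb, ez]
  have h2 : u ^ 2 - 1 ≠ 0 := by
    rw [← ez]
    exact sub_ne_zero.2 hz1
  have e3 : (u - u⁻¹) / 2 = (u ^ 2 - 1) / (2 * u) := by field_simp
  rw [e3]
  field_simp
  ring

/-- Partial fractions over the `N`-th roots of `(-1)^{N-1}`. -/
theorem sum_twistRoot_div {N p : ℕ} (hp : p < N) {l a : ℂ}
    (h : ∀ j ∈ dprimeIndex N, l + a * twistRoot N 1 j ≠ 0) (h0 : l ^ N + a ^ N ≠ 0) :
    ∑ j ∈ dprimeIndex N, twistRoot N (-p) j / (l + a * twistRoot N 1 j)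
      = N * l ^ (N - 1 - p) * (-a) ^ p / (l ^ N + a ^ N) := by
  have hN : N ≠ 0 := by omega
  -- Since (-aω_j)^N = -a^N for every j, each fraction is a finite geometric sum over the common
  -- denominator; orthogonality then keeps only i = p.
  have h1 : ∀ j ∈ dprimeIndex N, twistRoot N (-p) j / (l + a * twistRoot N 1 j)
      = (∑ i ∈ Finset.range N, (-a) ^ i * l ^ (N - 1 - i) * twistRoot N (i - p) j)
        / (l ^ N + a ^ N) := by
    intro j hj
    have e1 : (-a * twistRoot N 1 j) ^ N = - a ^ N := by
      rw [mul_pow, twistRoot_one_pow, twistRoot_natCast_self hN hj, neg_pow, mul_right_comm, ← pow_add,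
        show N + (N - 1) = 2 * (N - 1) + 1 by omega, pow_succ, pow_mul]
      simp
    have e2 := (Commute.all (-a * twistRoot N 1 j) l).mul_geom_sum₂ N
    rw [e1] at e2
    have e3 : ∑ i ∈ Finset.range N, (-a) ^ i * l ^ (N - 1 - i) * twistRoot N (i - p) j
        = twistRoot N (-p) j
          * ∑ i ∈ Finset.range N, (-a * twistRoot N 1 j) ^ i * l ^ (N - 1 - i) := by
      rw [Finset.mul_sum]
      refine Finset.sum_congr rfl fun i _ => ?_
      rw [sub_eq_add_neg, twistRoot_add, mul_pow, twistRoot_one_pow]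
      ring
    rw [e3, div_eq_div_iff (h j hj) h0]
    linear_combination twistRoot N (-p) j * e2
  rw [Finset.sum_congr rfl h1, ← Finset.sum_div, Finset.sum_comm]
  congr 1
  simp only [← Finset.mul_sum]
  rw [Finset.sum_eq_single_of_mem p (Finset.mem_range.2 hp)]
  · simp [twistRoot_zero, card_dprimeIndex]
    ring
  · intro i hi hip
    rw [sum_twistRoot_eq_zero hN, mul_zero]
    rw [Finset.mem_range] at hi
    intro hd
    have := Int.eq_zero_of_abs_lt_dvd hd (by rw [abs_lt]; omega)
    omega

/-! ### The twisted arguments and their logarithms. -/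

theorem twistArg_eq (N : ℕ) (j : ℤ) (x : ℂ) :
    twistArg N j x = 1 / x ^ (1 / (N : ℂ)) * twistRoot N 1 j := by
  rw [twistArg, twistRoot]
  push_cast
  rw [mul_one]
  ring

theorem twistArg_eq_exp {N : ℕ} {j : ℤ} {x : ℂ} (hx : x ≠ 0) :
    twistArg N j x = Complex.exp (-(Complex.I * Real.pi * j / N) - Complex.log x / N) := by
  rw [twistArg, Complex.cpow_def_of_ne_zero hx, Complex.exp_sub]
  ring_nf

/-- Here |j| ≤ N - 1 and |arg x| < π enter: the principal logarithm of the twisted argument needs no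
multiple of 2πi, and the argument avoids the cut. -/
theorem abs_im_twist_lt {N : ℕ} {j : ℤ} (hj : j ∈ dprimeIndex N) {x : ℂ}
    (hx : x ∈ Complex.slitPlane) :
    |(-(Complex.I * Real.pi * j / N) - Complex.log x / N).im| < Real.pi := by
  have h1 := abs_lt_of_mem_dprimeIndex hj
  have hN : 0 < N := by
    have := abs_nonneg j
    omega
  have hN' : (0 : ℝ) < N := by exact_mod_cast hN
  have e : -(Complex.I * Real.pi * j / N) - Complex.log x / N
      = -((Complex.I * Real.pi * j + Complex.log x) / ((N : ℝ) : ℂ)) := by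
    push_cast
    ring
  have him : (-(Complex.I * Real.pi * j / N) - Complex.log x / N).im
      = -((Real.pi * j + x.arg) / N) := by
    rw [e, Complex.neg_im, Complex.div_ofReal_im]
    simp [Complex.log_im]
  rw [him, abs_neg, abs_div, abs_of_pos hN', div_lt_iff₀ hN']
  have ha : |x.arg| < Real.pi := by
    rw [abs_lt]
    exact ⟨Complex.neg_pi_lt_arg x, lt_of_le_of_ne (Complex.arg_le_pi x) (Complex.mem_slitPlane_iff_arg.1 hx).1⟩
  have hj' : (|j| : ℝ) ≤ N - 1 := by
    have : |j| ≤ (N : ℤ) - 1 := by omega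
    exact_mod_cast this
  calc |Real.pi * j + x.arg| ≤ |Real.pi * j| + |x.arg| := abs_add_le _ _
    _ < Real.pi * (N - 1) + Real.pi := by
      rw [abs_mul, abs_of_pos Real.pi_pos]
      have := Real.pi_pos
      have := mul_le_mul_of_nonneg_left hj' this.le
      linarith
    _ = _ := by ring

theorem log_twistArg {N : ℕ} {j : ℤ} (hj : j ∈ dprimeIndex N) {x : ℂ}
    (hx : x ∈ Complex.slitPlane) :
    Complex.log (twistArg N j x) = -(Complex.I * Real.pi * j / N) - Complex.log x / N := by
  have h := abs_lt.1 (abs_im_twist_lt hj hx)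
  rw [twistArg_eq_exp (Complex.slitPlane_ne_zero hx), Complex.log_exp h.1 h.2.le]

theorem twistArg_mem_slitPlane {N : ℕ} {j : ℤ} (hj : j ∈ dprimeIndex N) {x : ℂ}
    (hx : x ∈ Complex.slitPlane) : twistArg N j x ∈ Complex.slitPlane := by
  have h := abs_lt.1 (abs_im_twist_lt hj hx)
  rw [Complex.mem_slitPlane_iff_arg]
  constructor
  · rw [← Complex.log_im, log_twistArg hj hx]
    exact h.2.ne
  · rw [twistArg_eq_exp (Complex.slitPlane_ne_zero hx)]
    exact Complex.exp_ne_zero _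

/-- The log x part cancels by orthogonality; the part linear in j gives the π/sin term of the
theorem. -/
theorem sum_twistRoot_mul_log {N p : ℕ} (hN : N ≠ 0) (hp : ¬ (N : ℤ) ∣ p) {x : ℂ}
    (hx : x ∈ Complex.slitPlane) :
    ∑ j ∈ dprimeIndex N, twistRoot N (-p) j * Complex.log (twistArg N j x)
      = -(-1) ^ p * Real.pi / Complex.sin (Real.pi / N * p) := by
  have hN' : (N : ℂ) ≠ 0 := by exact_mod_cast hN
  have e : ∀ j ∈ dprimeIndex N, twistRoot N (-p) j * Complex.log (twistArg N j x)
      = -(Complex.I * Real.pi / N) * (j * twistRoot N (-p) j)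
        - Complex.log x / N * twistRoot N (-p) j := by
    intro j hj
    rw [log_twistArg hj hx]
    ring
  rw [Finset.sum_congr rfl e, Finset.sum_sub_distrib, ← Finset.mul_sum, ← Finset.mul_sum,
    sum_twistRoot_eq_zero hN (by simpa using hp), sum_mul_twistRoot_neg hN hp]
  rw [mul_zero, sub_zero, ← div_div]
  have := Complex.I_ne_zero
  field_simp

theorem succ_rpow_inv_pow (m : ℕ) {N : ℕ} (hN : N ≠ 0) :
    (((m : ℝ) + 1) ^ (1 / (N : ℝ))) ^ N = (m : ℝ) + 1 := by
  rw [one_div, Real.rpow_inv_natCast_pow (by positivity) hN]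

theorem cpow_one_div_natCast_pow (x : ℂ) {N : ℕ} (hN : N ≠ 0) : (x ^ (1 / (N : ℂ))) ^ N = x := by
  rw [one_div, Complex.cpow_nat_inv_pow x hN]

theorem one_add_ofReal_mul_mem_slitPlane {x : ℂ} (hx : x ∈ Complex.slitPlane) {r : ℝ} (hr : 0 ≤ r) :
    1 + (r : ℂ) * x ∈ Complex.slitPlane := by
  rcases hr.eq_or_lt with rfl | hr
  · simp
  · rw [add_comm]
    exact add_one_mem_slitPlane (ofReal_mul_mem_slitPlane hx hr)

theorem pow_add_div_ne_zero {x : ℂ} (hx : x ∈ Complex.slitPlane) {s t : ℝ} (hs : 0 < s)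
    (ht : 0 ≤ t) : (t : ℂ) + s / x ≠ 0 := by
  have h0 := Complex.slitPlane_ne_zero hx
  have hs' : (s : ℂ) ≠ 0 := by exact_mod_cast hs.ne'
  have h := Complex.slitPlane_ne_zero (one_add_ofReal_mul_mem_slitPlane hx (div_nonneg ht hs.le))
  have e : (t : ℂ) + s / x = s / x * (1 + ((t / s : ℝ) : ℂ) * x) := by
    push_cast
    field_simp
    ring
  rw [e]
  exact mul_ne_zero (div_ne_zero hs' h0) h

/-- The partial fraction decomposition in the form in which it links the two double series. -/
theorem sum_twistRoot_div_add {N p : ℕ} (hp : p < N) {x : ℂ} (hx : x ∈ Complex.slitPlane)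
    {s t : ℝ} (hs : 0 < s) (ht : 0 ≤ t) :
    ∑ j ∈ dprimeIndex N, twistRoot N (-p) j / (t + s * twistArg N j x)
      = N * (t : ℂ) ^ (N - 1 - p) * (-(s / x ^ (1 / (N : ℂ)))) ^ p / ((t : ℂ) ^ N + (s : ℂ) ^ N / x) := by
  have hN : N ≠ 0 := by omega
  have e0 : (s / x ^ (1 / (N : ℂ))) ^ N = (s : ℂ) ^ N / x := by
    rw [div_pow, cpow_one_div_natCast_pow x hN]
  have e : ∀ j, (t : ℂ) + s * twistArg N j x = t + s / x ^ (1 / (N : ℂ)) * twistRoot N 1 j := by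
    intro j
    rw [twistArg_eq]
    ring
  have h := sum_twistRoot_div (l := (t : ℂ)) (a := s / x ^ (1 / (N : ℂ))) hp (fun j hj => by
    rw [← e j, add_comm]
    exact Complex.slitPlane_ne_zero (add_ofReal_mem_slitPlane
      (ofReal_mul_mem_slitPlane (twistArg_mem_slitPlane hj hx) hs) ht)) (by
    rw [e0]
    have := pow_add_div_ne_zero hx (pow_pos hs N) (pow_nonneg ht N)
    push_cast at this
    exact this)
  rw [e0] at h
  rw [← h]
  exact Finset.sum_congr rfl fun j _ => by rw [e j]

/-- Both sides vanish at t = 0 and have equal t-derivatives by the case p = 0 of the partial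
fractions, so no branches have to be tracked. -/
theorem sum_log_add_sub_log {N : ℕ} (hN : N ≠ 0) {x : ℂ} (hx : x ∈ Complex.slitPlane)
    {s t : ℝ} (hs : 0 < s) (ht : 0 ≤ t) :
    ∑ j ∈ dprimeIndex N, (Complex.log (s * twistArg N j x + t) - Complex.log (s * twistArg N j x))
      = Complex.log (1 + ((t ^ N / s ^ N : ℝ) : ℂ) * x) := by
  have h0 := Complex.slitPlane_ne_zero hx
  have hs' : (s : ℂ) ≠ 0 := by exact_mod_cast hs.ne'
  have hz : ∀ j ∈ dprimeIndex N, s * twistArg N j x ∈ Complex.slitPlane := fun j hj =>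
    ofReal_mul_mem_slitPlane (twistArg_mem_slitPlane hj hx) hs
  have hd : ∀ u ∈ Set.Icc (0 : ℝ) t, HasDerivWithinAt
      (fun u : ℝ => ∑ j ∈ dprimeIndex N, Complex.log (s * twistArg N j x + u)
        - Complex.log (1 + ((u ^ N / s ^ N : ℝ) : ℂ) * x)) 0 (Set.Icc 0 t) u := by
    intro u hu
    have hus : 0 ≤ u ^ N / s ^ N := div_nonneg (pow_nonneg hu.1 _) (by positivity)
    have h1 : HasDerivAt (fun u : ℝ => ∑ j ∈ dprimeIndex N, Complex.log (s * twistArg N j x + u))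
        (∑ j ∈ dprimeIndex N, 1 / (s * twistArg N j x + u)) u := by
      refine HasDerivAt.fun_sum fun j hj => ?_
      exact ((Complex.ofRealCLM.hasDerivAt (x := u)).const_add (s * twistArg N j x)).clog_real
        (add_ofReal_mem_slitPlane (hz j hj) hu.1)
    have h2 : HasDerivAt (fun u : ℝ => 1 + ((u ^ N / s ^ N : ℝ) : ℂ) * x)
        (((N * u ^ (N - 1) / s ^ N : ℝ) : ℂ) * x) u :=
      ((((hasDerivAt_pow N u).div_const (s ^ N)).ofReal_comp).mul_const x).const_add 1
    have h3 := h1.sub (h2.clog_real (one_add_ofReal_mul_mem_slitPlane hx hus))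
    refine (h3.congr_deriv ?_).hasDerivWithinAt
    have h4 := sum_twistRoot_div_add (p := 0) (Nat.pos_of_ne_zero hN) hx hs hu.1
    simp only [Nat.cast_zero, neg_zero, twistRoot_zero, pow_zero, mul_one, tsub_zero] at h4
    have h5 : ∑ j ∈ dprimeIndex N, 1 / (s * twistArg N j x + u)
        = ∑ j ∈ dprimeIndex N, 1 / (u + s * twistArg N j x) :=
      Finset.sum_congr rfl fun j _ => by rw [add_comm]
    rw [h5, h4, sub_eq_zero]
    have h6 := Complex.slitPlane_ne_zero (one_add_ofReal_mul_mem_slitPlane hx hus)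
    have h7 := pow_add_div_ne_zero hx (pow_pos hs N) (pow_nonneg hu.1 N)
    push_cast at h6 h7 ⊢
    rw [div_eq_div_iff h7 h6]
    field_simp
    ring
  have := norm_image_sub_le_of_norm_deriv_le_segment' hd (C := 0) (by simp) t ⟨ht, le_rfl⟩
  rw [zero_mul, norm_le_zero_iff, sub_eq_zero] at this
  simp only [Complex.ofReal_zero, add_zero, zero_pow hN, zero_div, zero_mul, Complex.log_one,
    sub_zero] at this
  rw [Finset.sum_sub_distrib, ← this]
  ring

theorem hasSum_log_div_succ_pow {k : ℕ} (hk : 1 < k) :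
    HasSum (fun n : ℕ => ((Real.log ((n : ℝ) + 1) / ((n : ℝ) + 1) ^ (k : ℝ) : ℝ) : ℂ))
      (-deriv riemannZeta k) := by
  have hk' : 1 < ((k : ℂ)).re := by simpa using hk
  have habs : LSeries.abscissaOfAbsConv 1 < ((k : ℂ)).re := by
    rw [LSeries.abscissaOfAbsConv_one]
    exact_mod_cast hk'
  have hd : deriv riemannZeta k = -LSeries (LSeries.logMul 1) k := by
    rw [← LSeries_deriv habs]
    apply Filter.EventuallyEq.deriv_eq
    filter_upwards [(isOpen_lt continuous_const Complex.continuous_re).mem_nhds hk'] with s hs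
    rw [LSeries_one_eq_riemannZeta hs]
  have h := (LSeriesSummable_logMul_of_lt_re habs).LSeriesHasSum
  rw [hd, neg_neg]
  have h1 := (hasSum_nat_add_iff' 1).2 h
  simp only [Finset.range_one, Finset.sum_singleton, LSeries.term_zero, sub_zero] at h1
  refine h1.congr_fun fun n => ?_
  rw [LSeries.term_of_ne_zero n.succ_ne_zero, LSeries.logMul, Real.rpow_natCast, Complex.cpow_natCast]
  push_cast
  rw [Complex.ofReal_log (by positivity)]
  simp

/-! ### The double series and the case 1 < k ≤ N. -/

/-- The terms of the double series behind the functional equation. -/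
noncomputable def doubleTerm (k N : ℕ) (x : ℂ) (n m : ℕ) : ℂ :=
  (1 / ((m : ℂ) + 1) - 1 / (((((n : ℝ) + 1) ^ (N : ℝ) : ℝ) : ℂ) * x + (m + 1)))
    / ((((n : ℝ) + 1) ^ (k : ℝ) : ℝ) : ℂ)

/-- An interpolation that trades growth in a for decay in b, so that the double series is dominated
by a product of two series. -/
theorem div_mul_add_le_rpow {a b ε : ℝ} (ha : 0 < a) (hb : 0 < b) (h0 : 0 ≤ ε) (h1 : ε ≤ 1) :
    a / (b * (a + b)) ≤ a ^ ε * (1 / b ^ (1 + ε)) := by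
  have h2 : a ^ (1 - ε) * b ^ ε ≤ a + b := by
    calc a ^ (1 - ε) * b ^ ε ≤ (a + b) ^ (1 - ε) * (a + b) ^ ε := by
          gcongr <;> linarith
      _ = a + b := by
          rw [← Real.rpow_add (by positivity), sub_add_cancel, Real.rpow_one]
  have e1 : a ^ ε * a ^ (1 - ε) = a := by
    rw [← Real.rpow_add ha, add_sub_cancel, Real.rpow_one]
  have e2 : b ^ (1 + ε) = b * b ^ ε := by rw [Real.rpow_add hb, Real.rpow_one]
  have := Real.rpow_pos_of_pos hb ε
  have := Real.rpow_pos_of_pos ha ε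
  rw [e2, mul_one_div, div_le_div_iff₀ (by positivity) (by positivity)]
  calc a * (b * b ^ ε) = a ^ ε * (b * (a ^ (1 - ε) * b ^ ε)) := by
        nth_rewrite 1 [← e1]
        ring
    _ ≤ _ := by gcongr

theorem summable_doubleTerm {k N : ℕ} (hk : 1 < k) (hN : N ≠ 0) {x : ℂ} (hx : x ∈ Complex.slitPlane) :
    Summable (Function.uncurry (doubleTerm k N x)) := by
  obtain ⟨c, hc, h⟩ := exists_sectorBound hx
  have hx0 : 0 < ‖x‖ := norm_pos_iff.2 (Complex.slitPlane_ne_zero hx)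
  have hN' : (0 : ℝ) < N := by exact_mod_cast Nat.pos_of_ne_zero hN
  have hN1 : (1 : ℝ) ≤ N := by exact_mod_cast Nat.one_le_iff_ne_zero.2 hN
  -- Then n^{Nε} = n^{1/2}: the exponents become k - 1/2 in n and 1 + ε in m, both above 1 because k
  -- ≥ 2.
  set ε : ℝ := 1 / (2 * N) with hε
  have hε0 : 0 < ε := by positivity
  have hε1 : ε ≤ 1 := by
    rw [hε, div_le_one (by positivity)]
    linarith
  have hNε : (N : ℝ) * ε = 1 / 2 := by
    rw [hε]
    field_simp
  have hk' : (2 : ℝ) ≤ k := by exact_mod_cast hk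
  have hs1 := summable_one_div_succ_rpow (p := k - 1 / 2) (by linarith)
  have hs2 := summable_one_div_succ_rpow (p := 1 + ε) (by linarith)
  have hs := (hs1.mul_of_nonneg hs2 (fun _ => by positivity) (fun _ => by positivity)).mul_left
    (‖x‖ ^ ε / c)
  refine Summable.of_norm_bounded hs ?_
  rintro ⟨n, m⟩
  have ht := succ_rpow_pos n N
  have hb := (h.smul ht).norm_one_div_sub_le hc (ofReal_mul_mem_slitPlane hx ht) m
  have hm : (0 : ℝ) < (m : ℝ) + 1 := by positivity
  rw [norm_mul, Complex.norm_of_nonneg ht.le] at hb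
  have hb2 := div_mul_add_le_rpow (mul_pos ht hx0) hm hε0.le hε1
  have hkp := succ_rpow_pos n k
  simp only [Function.uncurry, doubleTerm]
  rw [norm_div, Complex.norm_of_nonneg hkp.le]
  calc _ ≤ ((((n : ℝ) + 1) ^ (N : ℝ) * ‖x‖) / (c * ((m + 1) * (((n : ℝ) + 1) ^ (N : ℝ) * ‖x‖ + (m + 1)))))
        / ((n : ℝ) + 1) ^ (k : ℝ) := by gcongr
    _ = (1 / c) * ((((n : ℝ) + 1) ^ (N : ℝ) * ‖x‖) / ((m + 1) * (((n : ℝ) + 1) ^ (N : ℝ) * ‖x‖ + (m + 1))))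
        / ((n : ℝ) + 1) ^ (k : ℝ) := by field_simp
    _ ≤ (1 / c) * ((((n : ℝ) + 1) ^ (N : ℝ) * ‖x‖) ^ ε * (1 / ((m : ℝ) + 1) ^ (1 + ε)))
        / ((n : ℝ) + 1) ^ (k : ℝ) := by gcongr
    _ = _ := by
      rw [Real.mul_rpow ht.le hx0.le, ← Real.rpow_mul (by positivity), hNε,
        Real.rpow_sub (by positivity)]
      field_simp

theorem hasSum_doubleTerm_right {k N : ℕ} {x : ℂ} (hx : x ∈ Complex.slitPlane) (n : ℕ) :
    HasSum (doubleTerm k N x n)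
      ((Complex.digamma (((((n : ℝ) + 1) ^ (N : ℝ) : ℝ) : ℂ) * x + 1) + Real.eulerMascheroniConstant)
        / ((((n : ℝ) + 1) ^ (k : ℝ) : ℝ) : ℂ)) :=
  (hasSum_digamma (ofReal_mul_mem_slitPlane hx (succ_rpow_pos n N))).div_const _

theorem not_dvd_of_pos_of_lt {N p : ℕ} (hp : 0 < p) (hpN : p < N) : ¬ (N : ℤ) ∣ p := by
  rw [Int.natCast_dvd_natCast]
  exact Nat.not_dvd_of_pos_of_lt hp hpN

theorem succ_rpow_one_div_pow (m N p : ℕ) :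
    ((((m : ℝ) + 1) ^ (1 / (N : ℝ)) : ℝ)) ^ p = ((m : ℝ) + 1) ^ ((p : ℝ) / N) := by
  rw [← Real.rpow_natCast, ← Real.rpow_mul (by positivity)]
  congr 1
  ring

/-- The term equals n^{N-1-p} / (m (n^N + m/x)), the partial fraction sum with t = n and s = m^{1/N}
up to a factor free of n. -/
theorem doubleTerm_eq_sum {N p : ℕ} (hpN : p < N) {x : ℂ}
    (hx : x ∈ Complex.slitPlane) (n m : ℕ) :
    doubleTerm (p + 1) N x n m
      = (∑ j ∈ dprimeIndex N, twistRoot N (-p) j /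
          (((((m : ℝ) + 1) ^ (1 / (N : ℝ)) : ℝ) : ℂ) * twistArg N j x + (n + 1)))
        / (N * (-(1 / x ^ (1 / (N : ℂ)))) ^ p
          * ((((m : ℝ) + 1) ^ (((N : ℝ) + p) / N) : ℝ) : ℂ)) := by
  have hN : N ≠ 0 := by omega
  have hN' : (N : ℂ) ≠ 0 := by exact_mod_cast hN
  have hNr : (N : ℝ) ≠ 0 := by exact_mod_cast hN
  have hs := succ_rpow_pos m (1 / (N : ℝ))
  have h0 := Complex.slitPlane_ne_zero hx
  have hY : x ^ (1 / (N : ℂ)) ≠ 0 := by simp [Complex.cpow_eq_zero_iff, h0]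
  have h := sum_twistRoot_div_add hpN hx hs (t := (n : ℝ) + 1) (by positivity)
  have hne := pow_add_div_ne_zero hx (pow_pos hs N) (pow_nonneg (by positivity : (0 : ℝ) ≤ (n : ℝ) + 1) N)
  have e1 : ((m : ℝ) + 1) ^ (((N : ℝ) + p) / N)
      = ((m : ℝ) + 1) * (((m : ℝ) + 1) ^ (1 / (N : ℝ))) ^ p := by
    rw [succ_rpow_one_div_pow, add_div, div_self hNr, Real.rpow_add (by positivity), Real.rpow_one]
  have e2 : ∀ j ∈ dprimeIndex N, twistRoot N (-p) j /
      (((((m : ℝ) + 1) ^ (1 / (N : ℝ)) : ℝ) : ℂ) * twistArg N j x + (n + 1))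
      = twistRoot N (-p) j /
        ((((n : ℝ) + 1 : ℝ) : ℂ) + ((((m : ℝ) + 1) ^ (1 / (N : ℝ)) : ℝ) : ℂ) * twistArg N j x) := by
    intro j _
    rw [add_comm]
    push_cast
    rfl
  rw [Finset.sum_congr rfl e2, h, e1]
  have e5 : ((((m : ℝ) + 1) ^ (1 / (N : ℝ)) : ℝ) : ℂ) ^ N = (((m : ℝ) + 1 : ℝ) : ℂ) := by
    rw [← Complex.ofReal_pow, succ_rpow_inv_pow m hN]
  rw [e5]
  rw [succ_rpow_inv_pow m hN] at hne
  set s : ℝ := ((m : ℝ) + 1) ^ (1 / (N : ℝ))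
  have hs' : (s : ℂ) ≠ 0 := by exact_mod_cast hs.ne'
  have hn1 := natCast_succ_ne_zero n
  have hm1 := natCast_succ_ne_zero m
  have hz := add_natCast_succ_ne_zero (ofReal_mul_mem_slitPlane hx (succ_rpow_pos n N)) m
  rw [doubleTerm]
  simp only [Real.rpow_natCast] at hz ⊢
  obtain ⟨q, rfl⟩ : ∃ q, N = q + 1 + p := ⟨N - 1 - p, by omega⟩
  have e3 : q + 1 + p - 1 - p = q := by omega
  rw [e3]
  push_cast at hz hne ⊢
  have hd : ((n : ℂ) + 1) ^ (q + 1 + p) * x + (m + 1) = x * (((n : ℂ) + 1) ^ (q + 1 + p) + (m + 1) / x) := by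
    field_simp
  rw [hd] at hz ⊢
  have e4 : (-((s : ℂ) / x ^ (1 / ((q : ℂ) + 1 + p)))) ^ p
      = s ^ p * (-(1 / x ^ (1 / ((q : ℂ) + 1 + p)))) ^ p := by
    rw [← mul_pow]
    congr 1
    ring
  rw [e4]
  push_cast at hY hN'
  have hb : (-(1 / x ^ (1 / ((q : ℂ) + 1 + p)))) ^ p ≠ 0 :=
    pow_ne_zero _ (neg_ne_zero.2 (one_div_ne_zero hY))
  generalize (-(1 / x ^ (1 / ((q : ℂ) + 1 + p)))) ^ p = b at hb ⊢
  rw [div_sub_div _ _ hm1 hz]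
  field_simp
  ring

/-- For 0 < p < N the vanishing of ∑_j ω_j^{-p} allows 1/n to be subtracted from each fraction, so
each j gives a convergent digamma series, and removes γ. -/
theorem hasSum_doubleTerm_left {N p : ℕ} (hp : 0 < p) (hpN : p < N) {x : ℂ}
    (hx : x ∈ Complex.slitPlane) (m : ℕ) :
    HasSum (fun n => doubleTerm (p + 1) N x n m)
      ((-∑ j ∈ dprimeIndex N, twistRoot N (-p) j
          * Complex.digamma (((((m : ℝ) + 1) ^ (1 / (N : ℝ)) : ℝ) : ℂ) * twistArg N j x + 1))
        / (N * (-(1 / x ^ (1 / (N : ℂ)))) ^ p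
          * ((((m : ℝ) + 1) ^ (((N : ℝ) + p) / N) : ℝ) : ℂ))) := by
  have hN : N ≠ 0 := by omega
  have h0 := sum_twistRoot_eq_zero hN (p := -p) (by simpa using not_dvd_of_pos_of_lt hp hpN)
  simp only [doubleTerm_eq_sum hpN hx]
  refine HasSum.div_const ?_ _
  have h1 := hasSum_sum (s := dprimeIndex N) fun j hj =>
    (hasSum_digamma (ofReal_mul_mem_slitPlane (twistArg_mem_slitPlane hj hx)
      (succ_rpow_pos m (1 / (N : ℝ))))).mul_left (twistRoot N (-p) j)
  have h2 := h1.neg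
  have e : -∑ j ∈ dprimeIndex N, twistRoot N (-p) j
        * (Complex.digamma (((((m : ℝ) + 1) ^ (1 / (N : ℝ)) : ℝ) : ℂ) * twistArg N j x + 1)
          + Real.eulerMascheroniConstant)
      = -∑ j ∈ dprimeIndex N, twistRoot N (-p) j
          * Complex.digamma (((((m : ℝ) + 1) ^ (1 / (N : ℝ)) : ℝ) : ℂ) * twistArg N j x + 1) := by
    simp only [mul_add, Finset.sum_add_distrib, ← Finset.sum_mul, h0]
    simp
  rw [e] at h2
  refine h2.congr_fun fun n => ?_
  simp only [mul_sub, Finset.sum_sub_distrib, ← Finset.sum_mul, h0]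
  simp [div_eq_mul_inv]

theorem sum_twistRoot_mul_digamma {N p : ℕ} (hp : 0 < p) (hpN : p < N) {x : ℂ}
    (hx : x ∈ Complex.slitPlane) {s : ℝ} (hs : 0 < s) :
    ∑ j ∈ dprimeIndex N, twistRoot N (-p) j * Complex.digamma (s * twistArg N j x + 1)
      = ∑ j ∈ dprimeIndex N, twistRoot N (-p) j
          * (Complex.digamma (s * twistArg N j x + 1) - Complex.log (s * twistArg N j x))
        - (-1) ^ p * Real.pi / Complex.sin (Real.pi / N * p) := by
  have hN : N ≠ 0 := by omega
  have hd := not_dvd_of_pos_of_lt hp hpN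
  have h0 := sum_twistRoot_eq_zero hN (p := -p) (by simpa using hd)
  have h1 : ∀ j ∈ dprimeIndex N, twistRoot N (-p) j * Complex.log (s * twistArg N j x)
      = twistRoot N (-p) j * (Real.log s : ℂ) + twistRoot N (-p) j * Complex.log (twistArg N j x) := by
    intro j hj
    rw [Complex.log_ofReal_mul hs (Complex.slitPlane_ne_zero (twistArg_mem_slitPlane hj hx)), mul_add]
  simp only [mul_sub]
  rw [Finset.sum_sub_distrib, Finset.sum_congr rfl h1, Finset.sum_add_distrib, ← Finset.sum_mul, h0,
    sum_twistRoot_mul_log hN hd hx]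
  ring

/-- Dividing by the twisted argument changes ω_j^{-p} into x^{1/N} ω_j^{-(p+1)}, whose sum vanishes
unless p + 1 = N. -/
theorem sum_twistRoot_div_twistArg {N p : ℕ} (hpN : p < N) (x : ℂ) :
    (-1) ^ p * ∑ j ∈ dprimeIndex N, twistRoot N (-p) j / twistArg N j x
      * riemannZeta (1 + ((p + 1 : ℕ) : ℂ) / N) = -N * bTerm (p + 1) N x := by
  have hN : N ≠ 0 := by omega
  have hN' : (N : ℂ) ≠ 0 := by exact_mod_cast hN
  have e : ∀ j, twistRoot N (-p) j / twistArg N j x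
      = x ^ (1 / (N : ℂ)) * twistRoot N (-(p + 1 : ℕ)) j := by
    intro j
    have h := twistRoot_add N (-(p + 1 : ℕ)) 1 j
    have e1 : -((p + 1 : ℕ) : ℤ) + 1 = -p := by push_cast; ring
    have hne : twistRoot N 1 j ≠ 0 := Complex.exp_ne_zero _
    rw [e1] at h
    rw [twistArg_eq, h]
    field_simp
  rw [← Finset.sum_mul]
  simp only [e, ← Finset.mul_sum]
  rw [bTerm]
  split_ifs with hk
  · rw [hk, Finset.sum_congr rfl fun j hj => twistRoot_neg_natCast_self hN hj, Finset.sum_const,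
      card_dprimeIndex, nsmul_eq_mul]
    obtain rfl : N = p + 1 := hk.symm
    rw [Nat.add_sub_cancel, show p + 1 + (p + 1) + 1 = 2 * (p + 1) + 1 by ring, pow_succ _ (2 * (p + 1)), pow_mul]
    have : ((-1 : ℂ) ^ p) * (-1) ^ p = 1 := by rw [← mul_pow]; simp
    push_cast
    linear_combination (x ^ (1 / ((p : ℂ) + 1)) * (p + 1)
      * riemannZeta (1 + ((p : ℂ) + 1) / (p + 1))) * this
  · rw [sum_twistRoot_eq_zero hN]
    · simp
    · rw [dvd_neg]
      exact not_dvd_of_pos_of_lt (by omega) (by omega)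

theorem hasSum_log_smul_div {k N : ℕ} (hk : 1 < k) {x : ℂ} (hx : x ∈ Complex.slitPlane) :
    HasSum (fun n : ℕ => (Real.eulerMascheroniConstant
        + Complex.log (((((n : ℝ) + 1) ^ (N : ℝ) : ℝ) : ℂ) * x)) / ((((n : ℝ) + 1) ^ (k : ℝ) : ℝ) : ℂ))
      ((Real.eulerMascheroniConstant + Complex.log x) * riemannZeta k - N * deriv riemannZeta k) := by
  have hk' : (1 : ℝ) < k := by exact_mod_cast hk
  have h1 := (hasSum_one_div_succ_rpow hk').mul_left (Real.eulerMascheroniConstant + Complex.log x)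
  have h2 := (hasSum_log_div_succ_pow hk).mul_left (N : ℂ)
  have h3 := h1.add h2
  rw [Complex.ofReal_natCast, mul_neg, ← sub_eq_add_neg] at h3
  refine h3.congr_fun fun n => ?_
  rw [Complex.log_ofReal_mul (succ_rpow_pos n N) (Complex.slitPlane_ne_zero hx),
    Real.log_rpow (by positivity)]
  push_cast
  ring

/-- The exchange of summations: n-sums inside on one side, m-sums inside on the other. -/
theorem tsum_digamma_add_eulerMascheroni {N p : ℕ} (hp : 0 < p) (hpN : p < N) {x : ℂ}
    (hx : x ∈ Complex.slitPlane) :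
    ∑' n : ℕ, (Complex.digamma (((((n : ℝ) + 1) ^ (N : ℝ) : ℝ) : ℂ) * x + 1)
        + Real.eulerMascheroniConstant) / ((((n : ℝ) + 1) ^ ((p + 1 : ℕ) : ℝ) : ℝ) : ℂ)
      = (-∑ j ∈ dprimeIndex N, twistRoot N (-p) j
          * (extHerglotz (((N : ℝ) + p) / N) (1 / (N : ℝ)) (twistArg N j x)
            + riemannZeta (((((N : ℝ) + p) / N + 1 / N : ℝ)) : ℂ) / twistArg N j x)
        + (-1) ^ p * Real.pi / Complex.sin (Real.pi / N * p)
          * riemannZeta ((((N : ℝ) + p) / N : ℝ) : ℂ))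
        / (N * (-(1 / x ^ (1 / (N : ℂ)))) ^ p) := by
  have hN : N ≠ 0 := by omega
  have hN' : (0 : ℝ) < N := by exact_mod_cast Nat.pos_of_ne_zero hN
  have hp' : (0 : ℝ) < p := by exact_mod_cast hp
  have hK : 1 < ((N : ℝ) + p) / N := by
    rw [lt_div_iff₀ hN']
    linarith
  have hK1 : 1 < ((N : ℝ) + p) / N + 1 / N := by
    have : 0 < 1 / (N : ℝ) := by positivity
    linarith
  have e1 : ∀ n : ℕ, (Complex.digamma (((((n : ℝ) + 1) ^ (N : ℝ) : ℝ) : ℂ) * x + 1)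
        + Real.eulerMascheroniConstant) / ((((n : ℝ) + 1) ^ ((p + 1 : ℕ) : ℝ) : ℝ) : ℂ)
      = ∑' m, doubleTerm (p + 1) N x n m := fun n => (hasSum_doubleTerm_right hx n).tsum_eq.symm
  rw [tsum_congr e1, ← (summable_doubleTerm (by omega) hN hx).tsum_comm,
    tsum_congr fun m => (hasSum_doubleTerm_left hp hpN hx m).tsum_eq]
  have hS := hasSum_sum (s := dprimeIndex N) fun j hj =>
    ((summable_digamma_add_one_sub_log hK1 (twistArg_mem_slitPlane hj hx)).hasSum).mul_left
      (twistRoot N (-p) j)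
  have hZ := (hasSum_one_div_succ_rpow hK).mul_left
    ((-1) ^ p * Real.pi / Complex.sin (Real.pi / N * p))
  have h := (hS.neg.add hZ).div_const (N * (-(1 / x ^ (1 / (N : ℂ)))) ^ p)
  have e2 : ∀ j ∈ dprimeIndex N, twistRoot N (-p) j
          * (extHerglotz (((N : ℝ) + p) / N) (1 / (N : ℝ)) (twistArg N j x)
            + riemannZeta (((((N : ℝ) + p) / N + 1 / N : ℝ)) : ℂ) / twistArg N j x)
      = twistRoot N (-p) j * _ := fun j hj => by
    rw [extHerglotz_eq hK1 (twistArg_mem_slitPlane hj hx), sub_add_cancel]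
  rw [Finset.sum_congr rfl e2, ← h.tsum_eq]
  refine tsum_congr fun m => ?_
  rw [sum_twistRoot_mul_digamma hp hpN hx (succ_rpow_pos m (1 / (N : ℝ)))]
  simp only [← mul_div_assoc, ← Finset.sum_div]
  have hm : ((((m : ℝ) + 1) ^ (((N : ℝ) + p) / N) : ℝ) : ℂ) ≠ 0 := by
    exact_mod_cast (succ_rpow_pos m _).ne'
  rw [div_mul_eq_div_div _ _ ((((m : ℝ) + 1) ^ (((N : ℝ) + p) / N) : ℝ) : ℂ), div_right_comm]
  congr 1
  push_cast at hm ⊢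
  field_simp
  ring

theorem functional_equation_of_lt {N p : ℕ} (hp : 0 < p) (hpN : p < N) {x : ℂ}
    (hx : x ∈ Complex.slitPlane) :
    (1 / x ^ (1 / (N : ℂ))) ^ p * extHerglotz ((p + 1 : ℕ) : ℝ) N x
          - (-1) ^ (p + 1) / (N : ℂ) * ∑ j ∈ dprimeIndex N, twistRoot N (-p) j
                * extHerglotz (((N : ℝ) + p) / N) (1 / (N : ℝ)) (twistArg N j x)
        = Real.pi / (N : ℂ)
              * (riemannZeta ((((N : ℝ) + p) / N : ℝ) : ℂ) / Complex.sin (Real.pi / (N : ℂ) * p))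
          + (1 / x ^ (1 / (N : ℂ))) ^ p
              * (-(Real.eulerMascheroniConstant + Complex.log x) * riemannZeta ((p + 1 : ℕ) : ℂ)
                  + N * deriv riemannZeta ((p + 1 : ℕ) : ℂ))
          - (1 / x ^ (1 / (N : ℂ))) ^ p / x * riemannZeta (((p + 1 : ℕ) : ℂ) + N)
          + bTerm (p + 1) N x := by
  have hN : N ≠ 0 := by omega
  have hN' : (N : ℂ) ≠ 0 := by exact_mod_cast hN
  have h0 := Complex.slitPlane_ne_zero hx
  have hkN : (1 : ℝ) < ((p + 1 : ℕ) : ℝ) + N := by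
    have : 1 < p + 1 + N := by omega
    exact_mod_cast this
  have hA := tsum_digamma_add_eulerMascheroni hp hpN hx
  have hL := hasSum_log_smul_div (k := p + 1) (N := N) (by omega) hx
  have hS := (summable_digamma_add_one_sub_log hkN hx).hasSum
  have hF := extHerglotz_eq hkN hx
  have hB := sum_twistRoot_div_twistArg hpN x
  rw [eq_comm, sub_eq_iff_eq_add] at hF
  have hAL := hS.add hL
  have e1 : HasSum _ _ := hAL.congr_fun (g := fun n : ℕ =>
      (Complex.digamma (((((n : ℝ) + 1) ^ (N : ℝ) : ℝ) : ℂ) * x + 1)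
        + Real.eulerMascheroniConstant) / ((((n : ℝ) + 1) ^ ((p + 1 : ℕ) : ℝ) : ℝ) : ℂ)) fun n => by
    ring
  rw [e1.tsum_eq] at hA
  have hc : ((((p + 1 : ℕ) : ℝ) + (N : ℝ) : ℝ) : ℂ) = ((p + 1 : ℕ) : ℂ) + N := by push_cast; rfl
  have hc2 : (((((N : ℝ) + p) / N + 1 / N : ℝ)) : ℂ) = 1 + ((p + 1 : ℕ) : ℂ) / N := by
    push_cast
    field_simp
    ring
  rw [hc] at hF
  rw [hc2] at hA
  simp only [mul_add, Finset.sum_add_distrib] at hA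
  have e2 : ∑ j ∈ dprimeIndex N, twistRoot N (-p) j * (riemannZeta (1 + ((p + 1 : ℕ) : ℂ) / N) / twistArg N j x)
      = ∑ j ∈ dprimeIndex N, twistRoot N (-p) j / twistArg N j x
        * riemannZeta (1 + ((p + 1 : ℕ) : ℂ) / N) := Finset.sum_congr rfl fun j _ => by ring
  rw [e2, hF] at hA
  have hY : x ^ (1 / (N : ℂ)) ≠ 0 := by simp [Complex.cpow_eq_zero_iff, h0]
  have hb : (1 / x ^ (1 / (N : ℂ))) ^ p ≠ 0 := pow_ne_zero _ (one_div_ne_zero hY)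
  have hσ : (-1 : ℂ) ^ p * (-1) ^ p = 1 := by rw [← mul_pow]; simp
  have hσ0 : (-1 : ℂ) ^ p ≠ 0 := pow_ne_zero _ (by norm_num)
  rw [neg_pow (1 / x ^ (1 / (N : ℂ))), eq_div_iff (mul_ne_zero hN' (mul_ne_zero hσ0 hb))] at hA
  generalize (1 / x ^ (1 / (N : ℂ))) ^ p = b at hA hb ⊢
  generalize (∑ j ∈ dprimeIndex N, twistRoot N (-p) j / twistArg N j x
        * riemannZeta (1 + ((p + 1 : ℕ) : ℂ) / N)) = Q at hA hB
  generalize (∑ j ∈ dprimeIndex N, twistRoot N (-p) j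
    * extHerglotz (((N : ℝ) + p) / N) (1 / (N : ℝ)) (twistArg N j x)) = P at hA ⊢
  rw [pow_succ (-1 : ℂ) p]
  generalize (-1 : ℂ) ^ p = σ at hA hB hσ ⊢
  have hNi : (N : ℂ) * (N : ℂ)⁻¹ = 1 := mul_inv_cancel₀ hN'
  generalize hX : extHerglotz ((p + 1 : ℕ) : ℝ) N x + riemannZeta (((p + 1 : ℕ) : ℂ) + N) / x
    + ((Real.eulerMascheroniConstant + Complex.log x) * riemannZeta ((p + 1 : ℕ) : ℂ)
      - N * deriv riemannZeta ((p + 1 : ℕ) : ℂ)) = X at hA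
  generalize riemannZeta ((((N : ℝ) + p) / N : ℝ) : ℂ) = Z at hA ⊢
  -- Only σ² = 1 and N · N⁻¹ = 1 are needed besides the exchanged sums and the value of the 𝓑 term.
  linear_combination (σ / N) * hA - (N * (N : ℂ)⁻¹ * b * X
    - Real.pi / N * Z / Complex.sin (Real.pi / (N : ℂ) * p)) * hσ
    - (b * X - bTerm (p + 1) N x) * hNi - hB / N + b * hX

/-- The functional equation for `1 < k ≤ N`. -/
theorem functional_equation {k N : ℕ} (hk : 1 < k) (hkN : k ≤ N) {x : ℂ} (hx : x ∈ Complex.slitPlane) :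
    x ^ ((1 - (k : ℂ)) / N) * extHerglotz k N x
          - (-1) ^ k / (N : ℂ) * ∑ j ∈ dprimeIndex N,
              Complex.exp (Complex.I * Real.pi * (j : ℂ) * ((k : ℂ) - 1) / N)
                * extHerglotz (((N : ℝ) + k - 1) / N) (1 / (N : ℝ)) (twistArg N j x)
        = Real.pi / (N : ℂ)
              * (riemannZeta (1 + ((k : ℂ) - 1) / N)
                  / Complex.sin (Real.pi / (N : ℂ) * ((k : ℂ) - 1)))
          + x ^ ((1 - (k : ℂ)) / N)
              * (-(Real.eulerMascheroniConstant + Complex.log x) * riemannZeta k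
                  + N * deriv riemannZeta k)
          - 1 / x ^ (((N : ℂ) + k - 1) / N) * riemannZeta ((k : ℂ) + N)
          + bTerm k N x := by
  obtain ⟨p, rfl⟩ : ∃ p, k = p + 1 := ⟨k - 1, by omega⟩
  have hN' : (N : ℂ) ≠ 0 := by
    have : N ≠ 0 := by omega
    exact_mod_cast this
  have h0 := Complex.slitPlane_ne_zero hx
  have h := functional_equation_of_lt (N := N) (p := p) (by omega) (by omega) hx
  have e1 : (1 / x ^ (1 / (N : ℂ))) ^ p = x ^ ((1 - ((p + 1 : ℕ) : ℂ)) / N) := by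
    rw [div_pow, one_pow, ← Complex.cpow_nat_mul, one_div, ← Complex.cpow_neg]
    congr 1
    push_cast
    ring
  have e2 : x ^ ((1 - ((p + 1 : ℕ) : ℂ)) / N) / x = 1 / x ^ (((N : ℂ) + (p + 1 : ℕ) - 1) / N) := by
    rw [one_div, ← Complex.cpow_neg]
    nth_rewrite 2 [← Complex.cpow_one x]
    rw [← Complex.cpow_sub _ _ h0]
    congr 1
    push_cast
    field_simp
    ring
  have e3 : ((((N : ℝ) + p) / N : ℝ) : ℂ) = 1 + (((p + 1 : ℕ) : ℂ) - 1) / N := by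
    push_cast
    field_simp
    ring
  have e4 : ((N : ℝ) + p) / N = ((N : ℝ) + (p + 1 : ℕ) - 1) / N := by
    push_cast
    ring
  have e5 : (p : ℂ) = ((p + 1 : ℕ) : ℂ) - 1 := by push_cast; ring
  have e6 : ∀ j, twistRoot N (-p) j
      = Complex.exp (Complex.I * Real.pi * (j : ℂ) * (((p + 1 : ℕ) : ℂ) - 1) / N) := by
    intro j
    rw [twistRoot]
    congr 1
    push_cast
    ring
  rw [e3, e1, e2, e4, e5] at h
  simp only [e6] at h
  exact h

/-! ### The logarithmic sum L(Y) and its asymptotics. -/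

/-- The sum `∑_{m ≥ 1} log(1 + Y/m) / m`. -/
noncomputable def logSum (Y : ℂ) : ℂ := ∑' m : ℕ, Complex.log (1 + Y / (m + 1)) / (m + 1)

theorem summable_logSum (Y : ℂ) :
    Summable fun m : ℕ => Complex.log (1 + Y / (m + 1)) / ((m : ℂ) + 1) := by
  refine Summable.of_norm_bounded_eventually_nat
    (summable_one_div_nat_succ_sq.mul_left (3 / 2 * ‖Y‖)) ?_
  filter_upwards [Filter.eventually_ge_atTop ⌈2 * ‖Y‖⌉₊] with m hm
  have hm' : 2 * ‖Y‖ ≤ m := Nat.ceil_le.1 hm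
  have hm0 : (0 : ℝ) < (m : ℝ) + 1 := by positivity
  have h1 : ‖Y / ((m : ℂ) + 1)‖ ≤ 1 / 2 := by
    rw [norm_div, norm_natCast_succ, div_le_iff₀ hm0]
    linarith
  have h2 := Complex.norm_log_one_add_half_le_self h1
  rw [norm_div, norm_natCast_succ]
  rw [norm_div, norm_natCast_succ] at h2
  calc _ ≤ 3 / 2 * (‖Y‖ / (m + 1)) / (m + 1) := by gcongr
    _ = _ := by field_simp

theorem one_add_div_natCast_succ_mem_slitPlane {Y : ℂ} (hY : Y ∈ Complex.slitPlane) (m : ℕ) :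
    1 + Y / ((m : ℂ) + 1) ∈ Complex.slitPlane := by
  have := one_add_ofReal_mul_mem_slitPlane hY (r := 1 / ((m : ℝ) + 1)) (by positivity)
  push_cast at this
  rwa [one_div_mul_eq_div] at this

theorem hasDerivAt_logSum {Y : ℂ} (hY : Y ∈ Complex.slitPlane) :
    HasDerivAt logSum ((Complex.digamma (Y + 1) + Real.eulerMascheroniConstant) / Y) Y := by
  obtain ⟨c, hc, h⟩ := exists_sectorBound hY
  have h0 := Complex.slitPlane_ne_zero hY
  have hn : 0 < ‖Y‖ := norm_pos_iff.2 h0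
  obtain ⟨r, hr, hball⟩ := Metric.isOpen_iff.1 Complex.isOpen_slitPlane Y hY
  -- Moving Y by at most c‖Y‖/2 keeps ‖w + m‖ ≥ (c/2) m for all m ≥ 1.
  set ρ := min r (c * ‖Y‖ / 2) with hρ
  have hρ0 : 0 < ρ := lt_min hr (by positivity)
  have hmem : ∀ w ∈ Metric.ball Y ρ, w ∈ Complex.slitPlane := fun w hw =>
    hball (Metric.ball_subset_ball (min_le_left _ _) hw)
  have hg : ∀ (m : ℕ) (w : ℂ), w ∈ Metric.ball Y ρ →
      HasDerivAt (fun w : ℂ => Complex.log (1 + w / ((m : ℂ) + 1)) / ((m : ℂ) + 1))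
        (1 / (((m : ℂ) + 1) * (w + (m + 1)))) w := by
    intro m w hw
    have hm := natCast_succ_ne_zero m
    have hwm := add_natCast_succ_ne_zero (hmem w hw) m
    have h1 := ((((hasDerivAt_id w).div_const ((m : ℂ) + 1)).const_add 1).clog
      (one_add_div_natCast_succ_mem_slitPlane (hmem w hw) m)).div_const ((m : ℂ) + 1)
    refine h1.congr_deriv ?_
    have e : 1 + w / ((m : ℂ) + 1) = (w + (m + 1)) / (m + 1) := by
      field_simp
      ring
    simp only [id]
    rw [e]
    field_simp
  have hg' : ∀ (m : ℕ) (w : ℂ), w ∈ Metric.ball Y ρ →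
      ‖1 / (((m : ℂ) + 1) * (w + (m + 1)))‖ ≤ (2 / c) * (1 / ((m : ℝ) + 1) ^ 2) := by
    intro m w hw
    have h1 := h (m + 1) (by positivity)
    have h2 : ‖Y - w‖ ≤ c * ‖Y‖ / 2 := by
      rw [← dist_eq_norm, dist_comm]
      exact (Metric.mem_ball.1 hw).le.trans (min_le_right _ _)
    have h3 : ‖Y + (((m : ℝ) + 1 : ℝ) : ℂ)‖ ≤ ‖w + (m + 1)‖ + ‖Y - w‖ := by
      refine le_trans (le_of_eq ?_) (norm_add_le _ _)
      congr 1
      push_cast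
      ring
    have hm0 : (0 : ℝ) < (m : ℝ) + 1 := by positivity
    have h4 : c / 2 * ((m : ℝ) + 1) ≤ ‖w + (m + 1)‖ := by nlinarith
    rw [norm_div, norm_mul, norm_natCast_succ, norm_one]
    calc 1 / (((m : ℝ) + 1) * ‖w + (m + 1)‖) ≤ 1 / (((m : ℝ) + 1) * (c / 2 * ((m : ℝ) + 1))) := by
          gcongr
      _ = _ := by field_simp
  have hd := hasDerivAt_tsum_of_isPreconnected (summable_one_div_nat_succ_sq.mul_left (2 / c))
    Metric.isOpen_ball (convex_ball Y ρ).isPreconnected hg hg' (Metric.mem_ball_self hρ0)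
    (summable_logSum Y) (Metric.mem_ball_self hρ0)
  refine hd.congr_deriv ?_
  rw [← ((hasSum_digamma hY).div_const Y).tsum_eq]
  refine tsum_congr fun m => ?_
  have hm := natCast_succ_ne_zero m
  have hwm := add_natCast_succ_ne_zero hY m
  field_simp
  ring

/-- `logSum` minus its asymptotic main terms. -/
noncomputable def logSumRemainder (Y : ℂ) : ℂ :=
  logSum Y - Complex.log Y ^ 2 / 2 - Real.eulerMascheroniConstant * Complex.log Y

theorem hasDerivAt_logSumRemainder {Y : ℂ} (hY : Y ∈ Complex.slitPlane) :
    HasDerivAt logSumRemainder ((Complex.digamma (Y + 1) - Complex.log Y) / Y) Y := by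
  have hl := Complex.hasDerivAt_log hY
  have h := ((hasDerivAt_logSum hY).sub ((hl.pow 2).div_const 2)).sub
    (hl.const_mul (Real.eulerMascheroniConstant : ℂ))
  refine h.congr_deriv ?_
  have h0 := Complex.slitPlane_ne_zero hY
  push_cast
  field_simp
  ring

theorem norm_digamma_add_one_sub_log_le {z : ℂ} (hz : z ∈ Complex.slitPlane) :
    ‖Complex.digamma (z + 1) - Complex.log z‖ ≤ 2 / (‖z‖ + z.re) := by
  have h0 := Complex.slitPlane_ne_zero hz
  have hn : 0 < ‖z‖ := norm_pos_iff.2 h0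
  have hre := norm_add_re_pos hz
  refine ((sectorBound_sqrt h0).norm_digamma_sub_log_le (by positivity) hz).trans (le_of_eq ?_)
  rw [Real.sq_sqrt (by positivity)]
  field_simp

/-- The derivative is O(1/‖Y‖²) on the segment from t to tx, whose length is O(t), so the difference
is O(1/t). -/
theorem tendsto_logSumRemainder_sub {x : ℂ} (hx : x ∈ Complex.slitPlane) :
    Filter.Tendsto (fun t : ℝ => logSumRemainder (t * x) - logSumRemainder t)
      Filter.atTop (nhds 0) := by
  have hseg : ∀ u ∈ Set.Icc (0 : ℝ) 1, 1 + (u : ℂ) * (x - 1) ∈ Complex.slitPlane := by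
    intro u hu
    rcases hu.1.eq_or_lt with rfl | hu0
    · simp
    · have := add_ofReal_mem_slitPlane (ofReal_mul_mem_slitPlane hx hu0) (r := 1 - u) (by linarith [hu.2])
      push_cast at this
      convert this using 1
      ring
  have hcont : Continuous fun u : ℝ => (‖1 + (u : ℂ) * (x - 1)‖ + (1 + (u : ℂ) * (x - 1)).re)
      * ‖1 + (u : ℂ) * (x - 1)‖ := by fun_prop
  -- Compactness bounds the denominator (‖w‖ + Re w)‖w‖ of the derivative estimate away from 0 on
  -- the segment from 1 to x.
  obtain ⟨u₀, hu₀, hmin⟩ := isCompact_Icc.exists_isMinOn (Set.nonempty_Icc.2 zero_le_one)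
    hcont.continuousOn (s := Set.Icc (0 : ℝ) 1)
  set δ := (‖1 + (u₀ : ℂ) * (x - 1)‖ + (1 + (u₀ : ℂ) * (x - 1)).re) * ‖1 + (u₀ : ℂ) * (x - 1)‖ with hδ
  have hδ0 : 0 < δ := mul_pos (norm_add_re_pos (hseg u₀ hu₀))
    (norm_pos_iff.2 (Complex.slitPlane_ne_zero (hseg u₀ hu₀)))
  have hb : ∀ t : ℝ, 0 < t → ‖logSumRemainder (t * x) - logSumRemainder t‖
      ≤ (2 * ‖x - 1‖ / δ) * t⁻¹ := by
    intro t ht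
    have hd : ∀ u ∈ Set.Icc (0 : ℝ) 1, HasDerivWithinAt
        (fun u : ℝ => logSumRemainder (t * (1 + (u : ℂ) * (x - 1))))
        ((Complex.digamma (t * (1 + (u : ℂ) * (x - 1)) + 1) - Complex.log (t * (1 + (u : ℂ) * (x - 1))))
          / (t * (1 + (u : ℂ) * (x - 1))) * (t * (x - 1))) (Set.Icc 0 1) u := by
      intro u hu
      have h1 : HasDerivAt (fun u : ℝ => (t : ℂ) * (1 + (u : ℂ) * (x - 1))) (t * (x - 1)) u := by
        have := (((Complex.ofRealCLM.hasDerivAt (x := u)).mul_const (x - 1)).const_add 1).const_mul (t : ℂ)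
        simpa using this
      exact ((hasDerivAt_logSumRemainder (ofReal_mul_mem_slitPlane (hseg u hu) ht)).comp u h1
        |>.hasDerivWithinAt)
    have hbd : ∀ u ∈ Set.Ico (0 : ℝ) 1,
        ‖(Complex.digamma (t * (1 + (u : ℂ) * (x - 1)) + 1) - Complex.log (t * (1 + (u : ℂ) * (x - 1))))
          / (t * (1 + (u : ℂ) * (x - 1))) * (t * (x - 1))‖ ≤ (2 * ‖x - 1‖ / δ) * t⁻¹ := by
      intro u hu
      have hu' : u ∈ Set.Icc (0 : ℝ) 1 := ⟨hu.1, hu.2.le⟩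
      have h1 := norm_digamma_add_one_sub_log_le (ofReal_mul_mem_slitPlane (hseg u hu') ht)
      have h2 : δ ≤ _ := hmin hu'
      have h3 := norm_add_re_pos (hseg u hu')
      have h4 : 0 < ‖1 + (u : ℂ) * (x - 1)‖ :=
        norm_pos_iff.2 (Complex.slitPlane_ne_zero (hseg u hu'))
      simp only at h2
      rw [Complex.re_ofReal_mul, norm_mul (t : ℂ), Complex.norm_of_nonneg ht.le] at h1
      rw [norm_mul, norm_div, norm_mul (t : ℂ), norm_mul (t : ℂ), Complex.norm_of_nonneg ht.le]
      generalize ‖1 + (u : ℂ) * (x - 1)‖ = a at *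
      generalize (1 + (u : ℂ) * (x - 1)).re = b at *
      calc _ ≤ 2 / (t * a + t * b) / (t * a) * (t * ‖x - 1‖) := by gcongr
        _ = 2 * ‖x - 1‖ / ((a + b) * a) * t⁻¹ := by
          rw [← mul_add]
          field_simp
        _ ≤ _ := by gcongr
    have := norm_image_sub_le_of_norm_deriv_le_segment_01' hd hbd
    simpa using this
  rw [tendsto_zero_iff_norm_tendsto_zero]
  refine squeeze_zero' (Filter.Eventually.of_forall fun t => norm_nonneg _) ?_
    (by simpa using tendsto_inv_atTop_zero.const_mul (2 * ‖x - 1‖ / δ))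
  filter_upwards [Filter.eventually_gt_atTop 0] with t ht using hb t ht

/-! ### The case k = 1: truncation at n ≤ X. -/

/-- The truncated double series, summed in the other order. -/
theorem hasSum_truncated {N : ℕ} (hN : N ≠ 0) {x : ℂ} (hx : x ∈ Complex.slitPlane) (X : ℕ) :
    HasSum (fun m : ℕ => (∑ j ∈ dprimeIndex N,
        (Complex.digamma (((((m : ℝ) + 1) ^ (1 / (N : ℝ)) : ℝ) : ℂ) * twistArg N j x + X + 1)
          - Complex.digamma (((((m : ℝ) + 1) ^ (1 / (N : ℝ)) : ℝ) : ℂ) * twistArg N j x + 1)))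
          / (N * ((m : ℂ) + 1)))
      (∑ n ∈ Finset.range X,
        (Complex.digamma (((((n : ℝ) + 1) ^ (N : ℝ) : ℝ) : ℂ) * x + 1) + Real.eulerMascheroniConstant)
          / ((n : ℂ) + 1)) := by
  have h := hasSum_sum (s := Finset.range X) fun n _ => hasSum_doubleTerm_right (k := 1) (N := N) hx n
  have hNr : (N : ℝ) ≠ 0 := by exact_mod_cast hN
  simp only [Nat.cast_one, Real.rpow_one] at h
  push_cast at h ⊢
  refine h.congr_fun fun m => ?_
  have e1 : ∀ n, doubleTerm 1 N x n m = (∑ j ∈ dprimeIndex N, 1 /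
          (((((m : ℝ) + 1) ^ (1 / (N : ℝ)) : ℝ) : ℂ) * twistArg N j x + (n + 1))) / (N * ((m : ℂ) + 1)) := by
    intro n
    have := doubleTerm_eq_sum (p := 0) (Nat.pos_of_ne_zero hN) hx n m
    simp only [zero_add, Nat.cast_zero, neg_zero, twistRoot_zero, pow_zero, mul_one, add_zero,
      div_self hNr, Real.rpow_one] at this
    rw [this]
    push_cast
    rfl
  simp only [e1]
  rw [← Finset.sum_div, Finset.sum_comm]
  congr 1
  refine Finset.sum_congr rfl fun j hj => ?_
  have := sum_range_one_div_add (ofReal_mul_mem_slitPlane (twistArg_mem_slitPlane hj hx)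
    (succ_rpow_pos m (1 / (N : ℝ)))) X
  rw [← this]
  exact Finset.sum_congr rfl fun n _ => by rw [add_comm]

/-- Dominated convergence: each term is O(1/X), with a majorant m^{-1-1/N} independent of X. -/
theorem tendsto_tsum_digamma_sub_log {N : ℕ} (hN : N ≠ 0) {w : ℂ} (hw : w ∈ Complex.slitPlane) :
    (∀ X : ℕ, Summable fun m : ℕ =>
      (Complex.digamma (((((m : ℝ) + 1) ^ (1 / (N : ℝ)) : ℝ) : ℂ) * w + X + 1)
        - Complex.log (((((m : ℝ) + 1) ^ (1 / (N : ℝ)) : ℝ) : ℂ) * w + X)) / ((m : ℂ) + 1)) ∧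
    Filter.Tendsto (fun X : ℕ => ∑' m : ℕ,
      (Complex.digamma (((((m : ℝ) + 1) ^ (1 / (N : ℝ)) : ℝ) : ℂ) * w + X + 1)
        - Complex.log (((((m : ℝ) + 1) ^ (1 / (N : ℝ)) : ℝ) : ℂ) * w + X)) / ((m : ℂ) + 1))
      Filter.atTop (nhds 0) := by
  obtain ⟨c, hc, h⟩ := exists_sectorBound hw
  have hw0 : 0 < ‖w‖ := norm_pos_iff.2 (Complex.slitPlane_ne_zero hw)
  have hN' : (0 : ℝ) < N := by exact_mod_cast Nat.pos_of_ne_zero hN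
  -- Of the factors in c³, two come from the digamma bound and one from the sector bound for the
  -- shifted point.
  have hbound : ∀ X m : ℕ,
      ‖(Complex.digamma (((((m : ℝ) + 1) ^ (1 / (N : ℝ)) : ℝ) : ℂ) * w + X + 1)
        - Complex.log (((((m : ℝ) + 1) ^ (1 / (N : ℝ)) : ℝ) : ℂ) * w + X)) / ((m : ℂ) + 1)‖
      ≤ 1 / (c ^ 3 * (((m : ℝ) + 1) ^ (1 / (N : ℝ)) * ‖w‖ + X)) / ((m : ℝ) + 1) := by
    intro X m
    have hs := succ_rpow_pos m (1 / (N : ℝ))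
    have hsec := h.smul hs
    have hmem := ofReal_mul_mem_slitPlane hw hs
    have h1 := (hsec.add_ofReal hc.le (Nat.cast_nonneg X)).norm_digamma_sub_log_le hc
      (add_ofReal_mem_slitPlane hmem (Nat.cast_nonneg X))
    have h2 := hsec X (Nat.cast_nonneg X)
    rw [norm_mul, Complex.norm_of_nonneg hs.le] at h2
    rw [norm_div, norm_natCast_succ]
    gcongr
    rw [Complex.ofReal_natCast] at h1 h2
    refine h1.trans ?_
    rw [pow_succ c 2, mul_assoc (c ^ 2)]
    gcongr
  have hsum : Summable fun m : ℕ =>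
      1 / (c ^ 3 * ‖w‖) * (1 / ((m : ℝ) + 1) ^ (1 + 1 / (N : ℝ))) := by
    refine (summable_one_div_succ_rpow ?_).mul_left _
    have : 0 < 1 / (N : ℝ) := by positivity
    linarith
  have hbound' : ∀ X m : ℕ,
      ‖(Complex.digamma (((((m : ℝ) + 1) ^ (1 / (N : ℝ)) : ℝ) : ℂ) * w + X + 1)
        - Complex.log (((((m : ℝ) + 1) ^ (1 / (N : ℝ)) : ℝ) : ℂ) * w + X)) / ((m : ℂ) + 1)‖
      ≤ 1 / (c ^ 3 * ‖w‖) * (1 / ((m : ℝ) + 1) ^ (1 + 1 / (N : ℝ))) := by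
    intro X m
    have hs := succ_rpow_pos m (1 / (N : ℝ))
    refine (hbound X m).trans ?_
    calc _ ≤ 1 / (c ^ 3 * (((m : ℝ) + 1) ^ (1 / (N : ℝ)) * ‖w‖ + 0)) / ((m : ℝ) + 1) := by
          gcongr
          positivity
      _ = _ := by
        rw [Real.rpow_add (by positivity), Real.rpow_one]
        field_simp
        simp
  refine ⟨fun X => Summable.of_norm_bounded hsum (hbound' X), ?_⟩
  rw [← tsum_zero (β := ℕ)]
  refine tendsto_tsum_of_dominated_convergence hsum (fun m => ?_)
    (Filter.Eventually.of_forall fun X m => hbound' X m)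
  refine squeeze_zero_norm (hbound · m) ?_
  have h1 : Filter.Tendsto (fun X : ℕ => c ^ 3 * (((m : ℝ) + 1) ^ (1 / (N : ℝ)) * ‖w‖ + X))
      Filter.atTop Filter.atTop :=
    (Filter.tendsto_atTop_add_const_left _ _ tendsto_natCast_atTop_atTop).const_mul_atTop (by positivity)
  have h2 := (h1.inv_tendsto_atTop).div_const ((m : ℝ) + 1)
  rw [zero_div] at h2
  refine h2.congr fun X => ?_
  simp [one_div]

theorem sum_range_succ_eq_sum_Icc {M : Type*} [AddCommMonoid M] (f : ℕ → M) (X : ℕ) :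
    ∑ n ∈ Finset.range X, f (n + 1) = ∑ i ∈ Finset.Icc 1 X, f i := by
  induction X with
  | zero => simp
  | succ X ih => rw [Finset.sum_range_succ, ih, Finset.sum_Icc_succ_top (by omega)]

/-- The partial sums `∑_{n ≤ X} (ψ(n^N x + 1) + γ) / n`. -/
noncomputable def truncatedSum (N : ℕ) (x : ℂ) (X : ℕ) : ℂ :=
  ∑ n ∈ Finset.range X,
    (Complex.digamma (((((n : ℝ) + 1) ^ (N : ℝ) : ℝ) : ℂ) * x + 1) + Real.eulerMascheroniConstant)
      / ((n : ℂ) + 1)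

/-- The series `∑_{n ≥ 1} (ψ(n^N x + 1) - log(n^N x)) / n`. -/
noncomputable def digammaSum (N : ℝ) (x : ℂ) : ℂ :=
  ∑' n : ℕ, (Complex.digamma (((((n : ℝ) + 1) ^ N : ℝ) : ℂ) * x + 1)
    - Complex.log (((((n : ℝ) + 1) ^ N : ℝ) : ℂ) * x)) / ((n : ℂ) + 1)

theorem hasSum_digammaSum {N : ℝ} (hN : 0 < N) {x : ℂ} (hx : x ∈ Complex.slitPlane) :
    HasSum (fun n : ℕ => (Complex.digamma (((((n : ℝ) + 1) ^ N : ℝ) : ℂ) * x + 1)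
      - Complex.log (((((n : ℝ) + 1) ^ N : ℝ) : ℂ) * x)) / ((n : ℂ) + 1)) (digammaSum N x) := by
  have h := summable_digamma_add_one_sub_log (k := 1) (N := N) (by linarith) hx
  refine (h.congr fun n => ?_).hasSum
  rw [Real.rpow_one]
  push_cast
  rfl

theorem extHerglotz_one_eq {N : ℝ} (hN : 0 < N) {x : ℂ} (hx : x ∈ Complex.slitPlane) :
    extHerglotz 1 N x = digammaSum N x - riemannZeta (1 + N) / x := by
  rw [extHerglotz_eq (by linarith) hx, digammaSum]
  simp only [Real.rpow_one]
  push_cast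
  rfl

/-- Inserting log(sw + X) and log(sw) splits each digamma difference in three; the middle parts
combine over j into log(1 + X^N x/m). -/
theorem truncatedSum_eq {N : ℕ} (hN : N ≠ 0) {x : ℂ} (hx : x ∈ Complex.slitPlane) {X : ℕ}
    (hX : X ≠ 0) :
    truncatedSum N x X = (∑ j ∈ dprimeIndex N, ∑' m : ℕ,
      (Complex.digamma (((((m : ℝ) + 1) ^ (1 / (N : ℝ)) : ℝ) : ℂ) * twistArg N j x + X + 1)
        - Complex.log (((((m : ℝ) + 1) ^ (1 / (N : ℝ)) : ℝ) : ℂ) * twistArg N j x + X)) / ((m : ℂ) + 1)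
      + logSum ((X : ℂ) ^ N * x)
      - ∑ j ∈ dprimeIndex N, digammaSum (1 / N) (twistArg N j x)) / N := by
  have hN' : (0 : ℝ) < N := by exact_mod_cast Nat.pos_of_ne_zero hN
  have h1 := hasSum_sum (s := dprimeIndex N) fun j hj =>
    ((tendsto_tsum_digamma_sub_log hN (twistArg_mem_slitPlane hj hx)).1 X).hasSum
  have h2 := (summable_logSum ((X : ℂ) ^ N * x)).hasSum
  have h3 := hasSum_sum (s := dprimeIndex N) fun j hj =>
    hasSum_digammaSum (N := 1 / N) (by positivity) (twistArg_mem_slitPlane hj hx)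
  have h := ((h1.add h2).sub h3).div_const (N : ℂ)
  refine ((hasSum_truncated hN hx X).unique (h.congr_fun fun m => ?_))
  have hs := succ_rpow_pos m (1 / (N : ℝ))
  have h4 := sum_log_add_sub_log hN hx hs (t := X) (by positivity)
  rw [succ_rpow_inv_pow m hN] at h4
  have h5 : (((X : ℝ) ^ N / ((m : ℝ) + 1) : ℝ) : ℂ) * x = (X : ℂ) ^ N * x / (m + 1) := by
    push_cast
    ring
  rw [h5] at h4
  rw [← h4, ← Finset.sum_div, ← Finset.sum_div, mul_comm (N : ℂ), ← div_div, ← add_div, ← sub_div,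
    ← Finset.sum_add_distrib, ← Finset.sum_sub_distrib]
  congr 2
  refine Finset.sum_congr rfl fun j _ => ?_
  push_cast
  ring

theorem tendsto_logSum_sub_truncatedSum {N : ℕ} (hN : N ≠ 0) {x : ℂ} (hx : x ∈ Complex.slitPlane) :
    Filter.Tendsto (fun X : ℕ => logSum ((X : ℂ) ^ N * x) / N - truncatedSum N x X) Filter.atTop
      (nhds ((∑ j ∈ dprimeIndex N, digammaSum (1 / N) (twistArg N j x)) / N)) := by
  have h := tendsto_finsetSum (dprimeIndex N) fun j hj =>
    (tendsto_tsum_digamma_sub_log hN (twistArg_mem_slitPlane hj hx)).2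
  have h2 := (h.const_sub (∑ j ∈ dprimeIndex N, digammaSum (1 / N) (twistArg N j x))).div_const (N : ℂ)
  simp only [Finset.sum_const_zero, sub_zero] at h2
  refine h2.congr' ?_
  filter_upwards [Filter.eventually_ne_atTop 0] with X hX
  rw [truncatedSum_eq hN hx hX]
  ring

theorem tendsto_sum_log_div_sub :
    Filter.Tendsto (fun X : ℕ => ∑ n ∈ Finset.range X, (Real.log ((n : ℝ) + 1) : ℂ) / ((n : ℂ) + 1)
      - (Real.log X : ℂ) ^ 2 / 2) Filter.atTop (nhds (stieltjesOne : ℂ)) := by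
  refine ((Complex.continuous_ofReal.tendsto _).comp tendsto_stieltjesOneSeq).congr fun X => ?_
  rw [Function.comp_apply, stieltjesOneSeq, ← sum_range_succ_eq_sum_Icc (fun i : ℕ => Real.log i / i)]
  push_cast
  rfl

/-- The direct evaluation of the same partial sums: log(n^N x) = N log n + log x brings in γ₁ and γ.
-/
theorem tendsto_truncatedSum {N : ℕ} (hN : N ≠ 0) {x : ℂ} (hx : x ∈ Complex.slitPlane) :
    Filter.Tendsto (fun X : ℕ => truncatedSum N x X - N * (Real.log X : ℂ) ^ 2 / 2
        - (Real.eulerMascheroniConstant + Complex.log x) * Real.log X) Filter.atTop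
      (nhds (digammaSum N x + N * stieltjesOne
        + (Real.eulerMascheroniConstant + Complex.log x) * Real.eulerMascheroniConstant)) := by
  have hN' : (0 : ℝ) < N := by exact_mod_cast Nat.pos_of_ne_zero hN
  have h1 := (hasSum_digammaSum hN' hx).tendsto_sum_nat
  have h2 := tendsto_sum_log_div_sub.const_mul (N : ℂ)
  have h3 := tendsto_sum_one_div_sub_log.const_mul (Real.eulerMascheroniConstant + Complex.log x)
  refine ((h1.add h2).add h3).congr fun X => ?_
  have e : truncatedSum N x X
      = ∑ n ∈ Finset.range X, (Complex.digamma (((((n : ℝ) + 1) ^ (N : ℝ) : ℝ) : ℂ) * x + 1)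
          - Complex.log (((((n : ℝ) + 1) ^ (N : ℝ) : ℝ) : ℂ) * x)) / ((n : ℂ) + 1)
        + N * ∑ n ∈ Finset.range X, (Real.log ((n : ℝ) + 1) : ℂ) / ((n : ℂ) + 1)
        + (Real.eulerMascheroniConstant + Complex.log x) * ∑ n ∈ Finset.range X, 1 / ((n : ℂ) + 1) := by
    rw [truncatedSum, Finset.mul_sum, Finset.mul_sum, ← Finset.sum_add_distrib, ← Finset.sum_add_distrib]
    refine Finset.sum_congr rfl fun n _ => ?_
    rw [Complex.log_ofReal_mul (succ_rpow_pos n N) (Complex.slitPlane_ne_zero hx),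
      Real.log_rpow (by positivity)]
    push_cast
    ring
  rw [e]
  ring

/-! ### The constant, from N = 1 and x = 1. -/

/-- Symmetrising the sum of 1/(ln) over l ≤ n gives half the full square plus half the diagonal. -/
theorem sum_harmonic_div (X : ℕ) :
    ∑ n ∈ Finset.range X, (∑ l ∈ Finset.range (n + 1), 1 / ((l : ℂ) + 1)) / ((n : ℂ) + 1)
      = ((∑ l ∈ Finset.range X, 1 / ((l : ℂ) + 1)) ^ 2
        + ∑ l ∈ Finset.range X, 1 / ((l : ℂ) + 1) ^ 2) / 2 := by
  induction X with
  | zero => simp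
  | succ X ih =>
    rw [Finset.sum_range_succ, ih, Finset.sum_range_succ _ X, Finset.sum_range_succ _ X]
    have := natCast_succ_ne_zero X
    field_simp
    ring

theorem digamma_natCast_add_one (X : ℕ) :
    Complex.digamma ((X : ℂ) + 1)
      = ∑ l ∈ Finset.range X, 1 / ((l : ℂ) + 1) - Real.eulerMascheroniConstant := by
  induction X with
  | zero => simp [Complex.digamma_one]
  | succ X ih =>
    have h : ((X : ℂ) + 1) ∈ Complex.slitPlane := by
      simpa using Complex.natCast_mem_slitPlane.2 X.succ_ne_zero
    rw [Nat.cast_succ, digamma_add_one_of_mem_slitPlane h, ih, Finset.sum_range_succ]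
    ring

theorem truncatedSum_one_one (X : ℕ) :
    truncatedSum 1 1 X = ((∑ l ∈ Finset.range X, 1 / ((l : ℂ) + 1)) ^ 2
        + ∑ l ∈ Finset.range X, 1 / ((l : ℂ) + 1) ^ 2) / 2 := by
  rw [← sum_harmonic_div, truncatedSum]
  refine Finset.sum_congr rfl fun n _ => ?_
  have := digamma_natCast_add_one (n + 1)
  push_cast at this
  simp [this]

/-- The expression is (H - log X)² + 2(H - γ - log X) log X, and the digamma bound at X gives |H - γ
- log X| ≤ 1/X. -/
theorem tendsto_harmonic_sq_sub :
    Filter.Tendsto (fun X : ℕ => (∑ l ∈ Finset.range X, 1 / ((l : ℂ) + 1)) ^ 2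
        - (Real.log X : ℂ) ^ 2 - 2 * Real.eulerMascheroniConstant * Real.log X)
      Filter.atTop (nhds ((Real.eulerMascheroniConstant : ℂ) ^ 2)) := by
  have hlog : Filter.Tendsto (fun X : ℕ => Real.log X / X) Filter.atTop (nhds 0) := by
    exact Real.isLittleO_log_id_atTop.tendsto_div_nhds_zero.comp tendsto_natCast_atTop_atTop
  have h1 : Filter.Tendsto (fun X : ℕ => (∑ l ∈ Finset.range X, 1 / ((l : ℂ) + 1)
      - Real.eulerMascheroniConstant - Real.log X) * Real.log X) Filter.atTop (nhds 0) := by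
    refine squeeze_zero_norm' ?_ hlog
    filter_upwards [Filter.eventually_gt_atTop 0] with X hX
    have hX' : (0 : ℝ) < X := by exact_mod_cast hX
    have hX1 : (1 : ℝ) ≤ X := by exact_mod_cast hX
    have hs : (X : ℂ) ∈ Complex.slitPlane := Complex.natCast_mem_slitPlane.2 hX.ne'
    have h := norm_digamma_add_one_sub_log_le hs
    rw [digamma_natCast_add_one, Complex.norm_natCast, Complex.natCast_re, ← Complex.natCast_log] at h
    rw [norm_mul, Complex.norm_of_nonneg (Real.log_nonneg hX1)]
    calc _ ≤ 2 / ((X : ℝ) + X) * Real.log X := by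
          have := Real.log_nonneg hX1
          gcongr
      _ = _ := by field_simp; ring
  have h2 := (tendsto_sum_one_div_sub_log.pow 2).add (h1.const_mul 2)
  rw [mul_zero, add_zero] at h2
  refine h2.congr fun X => ?_
  ring

theorem dprimeIndex_one : dprimeIndex 1 = {0} := by
  simp [dprimeIndex]

theorem twistArg_one_zero (x : ℂ) : twistArg 1 0 x = 1 / x := by
  simp [twistArg]

theorem digammaSum_one_one :
    digammaSum 1 1 = (Real.pi : ℂ) ^ 2 / 12 - (Real.eulerMascheroniConstant : ℂ) ^ 2 / 2
      - stieltjesOne := by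
  have h := tendsto_truncatedSum one_ne_zero (x := 1) (by simp)
  have hz : Filter.Tendsto (fun X : ℕ => ∑ l ∈ Finset.range X, 1 / ((l : ℂ) + 1) ^ 2) Filter.atTop
      (nhds ((Real.pi : ℂ) ^ 2 / 6)) := by
    have := (hasSum_one_div_succ_rpow (p := 2) (by norm_num)).tendsto_sum_nat
    rw [Complex.ofReal_ofNat, riemannZeta_two] at this
    refine this.congr fun X => Finset.sum_congr rfl fun l _ => ?_
    rw [Real.rpow_two]
    push_cast
    rfl
  have h2 := ((tendsto_harmonic_sq_sub.add hz).div_const 2)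
  have h3 := tendsto_nhds_unique h (h2.congr fun X => by
    rw [truncatedSum_one_one]
    simp
    ring)
  simp only [Nat.cast_one, Complex.log_one, add_zero, one_mul] at h3
  linear_combination h3

/-- For N = 1, x = 1 the only twisted argument is again 1, so the known value `digammaSum_one_one`
enters twice and fixes the constant. -/
theorem tendsto_logSumRemainder_natCast :
    Filter.Tendsto (fun X : ℕ => logSumRemainder X) Filter.atTop
      (nhds ((Real.pi : ℂ) ^ 2 / 6 - stieltjesOne)) := by
  have h := (tendsto_logSum_sub_truncatedSum one_ne_zero (x := 1) (by simp)).add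
    (tendsto_truncatedSum one_ne_zero (x := 1) (by simp))
  simp only [dprimeIndex_one, Finset.sum_singleton, twistArg_one_zero, Nat.cast_one, div_one,
    Complex.log_one, add_zero, one_mul, digammaSum_one_one] at h
  have e : (Real.pi : ℂ) ^ 2 / 6 - stieltjesOne = (Real.pi : ℂ) ^ 2 / 12
      - (Real.eulerMascheroniConstant : ℂ) ^ 2 / 2 - stieltjesOne
      + ((Real.pi : ℂ) ^ 2 / 12 - (Real.eulerMascheroniConstant : ℂ) ^ 2 / 2 - stieltjesOne + stieltjesOne
        + (Real.eulerMascheroniConstant : ℂ) * Real.eulerMascheroniConstant) := by ring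
  rw [e]
  refine h.congr fun X => ?_
  rw [logSumRemainder, pow_one, mul_one, ← Complex.natCast_log]
  ring

theorem tendsto_logSumRemainder_pow_mul {N : ℕ} (hN : N ≠ 0) {x : ℂ} (hx : x ∈ Complex.slitPlane) :
    Filter.Tendsto (fun X : ℕ => logSumRemainder ((X : ℂ) ^ N * x)) Filter.atTop
      (nhds ((Real.pi : ℂ) ^ 2 / 6 - stieltjesOne)) := by
  have hp : Filter.Tendsto (fun X : ℕ => X ^ N) Filter.atTop Filter.atTop :=
    Filter.tendsto_pow_atTop hN
  have h1 := (tendsto_logSumRemainder_sub hx).comp (tendsto_natCast_atTop_atTop.comp hp)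
  have h2 := tendsto_logSumRemainder_natCast.comp hp
  have h := h1.add h2
  rw [zero_add] at h
  refine h.congr fun X => ?_
  simp

/-! ### Assembly. -/

/-- Adding the two limits cancels the truncated sum. Expanding log(X^N x) = N log X + log x in the
asymptotics of L cancels all divergent terms. -/
theorem digammaSum_functional_equation {N : ℕ} (hN : N ≠ 0) {x : ℂ} (hx : x ∈ Complex.slitPlane) :
    digammaSum N x + 1 / (N : ℂ) * ∑ j ∈ dprimeIndex N, digammaSum (1 / N) (twistArg N j x)
      = 1 / (N : ℂ) * ((Real.pi : ℂ) ^ 2 / 6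
          - ((N : ℂ) - 1) * Real.eulerMascheroniConstant * Complex.log x
          + 1 / 2 * Complex.log x ^ 2 - N * (Real.eulerMascheroniConstant : ℂ) ^ 2
          - ((N : ℂ) ^ 2 + 1) * stieltjesOne) := by
  have hN' : (N : ℂ) ≠ 0 := by exact_mod_cast hN
  have h := (tendsto_logSum_sub_truncatedSum hN hx).add (tendsto_truncatedSum hN hx)
  have h2 := ((tendsto_logSumRemainder_pow_mul hN hx).div_const (N : ℂ)).add_const
    ((Complex.log x ^ 2 / 2 + Real.eulerMascheroniConstant * Complex.log x) / N)
  have h3 := tendsto_nhds_unique h (h2.congr' (by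
    filter_upwards [Filter.eventually_gt_atTop 0] with X hX
    have hX' : (0 : ℝ) < (X : ℝ) ^ N := by
      have : (0 : ℝ) < X := by exact_mod_cast hX
      positivity
    have e : Complex.log ((X : ℂ) ^ N * x) = N * Real.log X + Complex.log x := by
      have := Complex.log_ofReal_mul hX' (Complex.slitPlane_ne_zero hx)
      rw [Real.log_pow] at this
      push_cast at this ⊢
      exact this
    rw [logSumRemainder, e]
    field_simp
    ring))
  field_simp at h3 ⊢
  linear_combination h3

/-- The companion formula for `k = 1`. -/
theorem functional_equation_one {N : ℕ} (hN : N ≠ 0) {x : ℂ} (hx : x ∈ Complex.slitPlane) :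
    extHerglotz 1 N x
          + 1 / (N : ℂ) * ∑ j ∈ dprimeIndex N, extHerglotz 1 (1 / (N : ℝ)) (twistArg N j x)
        = 1 / (N : ℂ)
              * ((Real.pi : ℂ) ^ 2 / 6
                  - ((N : ℂ) - 1) * Real.eulerMascheroniConstant * Complex.log x
                  + 1 / 2 * Complex.log x ^ 2
                  - N * (Real.eulerMascheroniConstant : ℂ) ^ 2
                  - ((N : ℂ) ^ 2 + 1) * stieltjesOne)
          - riemannZeta ((N : ℂ) + 1) / x
          + bTerm 1 N x := by
  have hN0 : (0 : ℝ) < N := by exact_mod_cast Nat.pos_of_ne_zero hN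
  have hN' : (N : ℂ) ≠ 0 := by exact_mod_cast hN
  have hB := sum_twistRoot_div_twistArg (p := 0) (Nat.pos_of_ne_zero hN) x
  simp only [pow_zero, one_mul, Nat.cast_zero, neg_zero, twistRoot_zero, zero_add, Nat.cast_one] at hB
  have e : ∀ j ∈ dprimeIndex N, extHerglotz 1 (1 / (N : ℝ)) (twistArg N j x)
      = digammaSum (1 / N) (twistArg N j x) - 1 / twistArg N j x * riemannZeta (1 + 1 / N) := by
    intro j hj
    rw [extHerglotz_one_eq (by positivity) (twistArg_mem_slitPlane hj hx)]
    push_cast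
    ring
  rw [← digammaSum_functional_equation hN hx, extHerglotz_one_eq hN0 hx, Finset.sum_congr rfl e,
    Finset.sum_sub_distrib, hB, add_comm (N : ℂ) 1]
  push_cast
  field_simp
  ring

theorem theorem2p1 :
    -- The functional equation for `1 < k ≤ N`, all series involved being convergent.
    (∀ k N : ℕ, 1 < k → k ≤ N → ∀ x : ℂ, x ∈ Complex.slitPlane →
      Summable (herglotzTerm k N x) ∧
      (∀ j ∈ dprimeIndex N,
        Summable (herglotzTerm (((N : ℝ) + k - 1) / N) (1 / (N : ℝ)) (twistArg N j x))) ∧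
      x ^ ((1 - (k : ℂ)) / N) * extHerglotz k N x
          - (-1) ^ k / (N : ℂ) * ∑ j ∈ dprimeIndex N,
              Complex.exp (Complex.I * Real.pi * (j : ℂ) * ((k : ℂ) - 1) / N)
                * extHerglotz (((N : ℝ) + k - 1) / N) (1 / (N : ℝ)) (twistArg N j x)
        = Real.pi / (N : ℂ)
              * (riemannZeta (1 + ((k : ℂ) - 1) / N)
                  / Complex.sin (Real.pi / (N : ℂ) * ((k : ℂ) - 1)))
          + x ^ ((1 - (k : ℂ)) / N)
              * (-(Real.eulerMascheroniConstant + Complex.log x) * riemannZeta k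
                  + N * deriv riemannZeta k)
          - 1 / x ^ (((N : ℂ) + k - 1) / N) * riemannZeta ((k : ℂ) + N)
          + bTerm k N x) ∧
    -- The companion formula for `k = 1`.
    (∀ N : ℕ, 1 ≤ N → ∀ x : ℂ, x ∈ Complex.slitPlane →
      Summable (herglotzTerm 1 N x) ∧
      (∀ j ∈ dprimeIndex N, Summable (herglotzTerm 1 (1 / (N : ℝ)) (twistArg N j x))) ∧
      extHerglotz 1 N x
          + 1 / (N : ℂ) * ∑ j ∈ dprimeIndex N, extHerglotz 1 (1 / (N : ℝ)) (twistArg N j x)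
        = 1 / (N : ℂ)
              * ((Real.pi : ℂ) ^ 2 / 6
                  - ((N : ℂ) - 1) * Real.eulerMascheroniConstant * Complex.log x
                  + 1 / 2 * Complex.log x ^ 2
                  - N * (Real.eulerMascheroniConstant : ℂ) ^ 2
                  - ((N : ℂ) ^ 2 + 1) * stieltjesOne)
          - riemannZeta ((N : ℂ) + 1) / x
          + bTerm 1 N x) ∧
    -- The special case `k = N = 1`: Zagier's relation between `F(x)` and `F(1/x)`.
    (∀ x : ℂ, x ∈ Complex.slitPlane →
      extHerglotz 1 1 x + extHerglotz 1 1 (1 / x)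
        = 2 * extHerglotz 1 1 1 + 1 / 2 * Complex.log x ^ 2
          - (Real.pi : ℂ) ^ 2 / (6 * x) * (x - 1) ^ 2) := by
  refine ⟨fun k N hk hkN x hx => ⟨summable_herglotzTerm ?_ hx, fun j hj =>
    summable_herglotzTerm ?_ (twistArg_mem_slitPlane hj hx), functional_equation hk hkN hx⟩,
    fun N hN x hx => ⟨summable_herglotzTerm ?_ hx, fun j hj =>
    summable_herglotzTerm ?_ (twistArg_mem_slitPlane hj hx),
    functional_equation_one (by omega) hx⟩, fun x hx => ?_⟩
  · have : 1 < k + N := by omega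
    exact_mod_cast this
  · have hN : (0 : ℝ) < N := by
      have : 0 < N := by omega
      exact_mod_cast this
    have hk' : (1 : ℝ) < k := by exact_mod_cast hk
    rw [← add_div, lt_div_iff₀ hN]
    linarith
  · have : (1 : ℝ) ≤ N := by exact_mod_cast hN
    linarith
  · have : (1 : ℝ) ≤ N := by exact_mod_cast hN
    have : 0 < 1 / (N : ℝ) := by positivity
    linarith
  -- Comparing with y = 1 trades the constant π²/6 - γ² - 2γ₁ for 2F(1) + π²/3.
  · have key : ∀ y : ℂ, y ∈ Complex.slitPlane → extHerglotz 1 1 y + extHerglotz 1 1 (1 / y)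
        = (Real.pi : ℂ) ^ 2 / 6 + 1 / 2 * Complex.log y ^ 2 - (Real.eulerMascheroniConstant : ℂ) ^ 2
          - 2 * stieltjesOne - (Real.pi : ℂ) ^ 2 / 6 / y - y * ((Real.pi : ℂ) ^ 2 / 6) := by
      intro y hy
      have h := functional_equation_one one_ne_zero hy
      simp only [dprimeIndex_one, Finset.sum_singleton, twistArg_one_zero, Nat.cast_one, div_one,
        one_mul, bTerm, if_true, Complex.cpow_one, one_add_one_eq_two, riemannZeta_two] at h
      rw [h]
      ring
    have h1 := key 1 (by simp)
    have hx0 := Complex.slitPlane_ne_zero hx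
    rw [key x hx]
    simp only [div_one, Complex.log_one] at h1
    field_simp
    linear_combination (-12 * x) * h1
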